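/- Let $\sigma_x,\sigma_y,\sigma_z$ be the Pauli matrices, $\|\cdot\|$ the spectral norm, and $k\ge 0$ an integer. Put $|\phi_k\rangle=|0\rangle$ if $k$ is odd and $|\phi_k\rangle=(|0\rangle+|1\rangle)/\sqrt2$ if $k$ is even. There is a constant $C>0$, depending only on $k$, such that the following holds for all positive integers $p$, all $m,n$, all pairwise commuting Hermitian $n\times n$ matrices $A_1,\dots,A_m$, and all integers $\alpha_1,\dots,\alpha_m\ge 0$ with $\left(\sum_{\ell}\alpha_\ell\right)-1=k$. Write $P=A_1^{\alpha_1}\cdots A_m^{\alpha_m}$, let $\mathcal A_0,\dots,\mathcal A_k$ be any list in which $A_\ell$ is entered $\alpha_\ell$ times for each $\ell$, and set $\mathcal A_0'=\mathcal A_0\otimes\sigma_x$ and $\mathcal A_j'=\mathcal A_j\otimes\sigma_y$ for $1\le j\le k$ (operators on $\mathbb C^n\otimes\mathbb C^2$). (i) The nested commutator of the dilated operators is the dilated product: $$[\mathcal A_k',[\mathcal A_{k-1}',[\dots,[\mathcal A_1',\mathcal A_0']\dots]]]=\begin{cases}-i\,2^k\,P\otimes\sigma_z,& k\text{ odd},\\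 2^k\,P\otimes\sigma_x,& k\text{ even}.\end{cases}$$ (ii) For all $\Lambda\ge 2\max_\ell\|A_\ell\|$, $t\ge 0$ and $\epsilon>0$, the evolution $\exp(-i2^kA_1^{\alpha_1}\cdots A_m^{\alpha_m}t^{k+1})$ can be simulated with error at most $\epsilon$ by a product of $N_{\exp}$ exponentials of the dilated operators, with the ancilla qubit in the state $|\phi_k\rangle$. That is, there are $j_1,\dots,j_{N_{\exp}}\in\{0,\dots,k\}$ and $\tau_1,\dots,\tau_{N_{\exp}}\in\mathbb R$ such that $V=\prod_{q=1}^{N_{\exp}}\exp(-i\tau_q\mathcal A_{j_q}')$ satisfies $$\left\|V(\psi\otimes\phi_k)-\left(e^{-i2^kPt^{k+1}}\psi\right)\otimes\phi_k\right\|\le\epsilon\|\psi\|\quad\text{for all }\psi\in\mathbb C^n,$$ where $$N_{\exp}\le C\cdot 6^{pk}\max\{1,F\},\qquad F=\frac{(6^{pk}\Lambda t)^{k+1+(k+1)^2/(2p)}}{\epsilon^{(k+1)/(2p)}},$$ and moreover $N_{\exp}\le C\cdot 6^{pk}F$ whenever $\Lambda t\ge 1$. In other words, $$N_{\exp}\in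 O\!\left(\frac{6^{pk}(6^{pk}\Lambda t)^{k+1+(k+1)^2/(2p)}}{\epsilon^{(k+1)/(2p)}}\right)$$ with an implied constant that depends only on $k$. -/

import Mathlib

open scoped Kronecker Matrix.Norms.L2Operator

noncomputable section

/-- The Pauli matrix `σ_x`. -/
def pauliX : Matrix (Fin 2) (Fin 2) ℂ := !![0, 1; 1, 0]

/-- The Pauli matrix `σ_y`. -/
def pauliY : Matrix (Fin 2) (Fin 2) ℂ := !![0, -Complex.I; Complex.I, 0]

/-- The Pauli matrix `σ_z`. -/
def pauliZ : Matrix (Fin 2) (Fin 2) ℂ := !![1, 0; 0, -1]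

/-- The ordered product `A_1 ^ α_1 * ⋯ * A_m ^ α_m`. -/
def powerProduct {m n : ℕ} (A : Fin m → Matrix (Fin n) (Fin n) ℂ) (α : Fin m → ℕ) :
    Matrix (Fin n) (Fin n) ℂ :=
  (List.ofFn fun l => A l ^ α l).prod

/-- The Pauli matrix attached to the `j`-th factor: `σ_x` for `j = 0` and `σ_y` for `j > 0`. -/
def dilationPauli {k : ℕ} (j : Fin (k + 1)) : Matrix (Fin 2) (Fin 2) ℂ :=
  if j = 0 then pauliX else pauliY

/-- The one-qubit dilation of a list `B_0, …, B_k` of matrices: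
`B_0 ⊗ σ_x, B_1 ⊗ σ_y, …, B_k ⊗ σ_y`. -/
def dilation {n k : ℕ} (B : Fin (k + 1) → Matrix (Fin n) (Fin n) ℂ) (j : Fin (k + 1)) :
    Matrix (Fin n × Fin 2) (Fin n × Fin 2) ℂ :=
  B j ⊗ₖ dilationPauli j

/-- The nested commutator `[X_k, [X_{k-1}, […, [X_1, X_0] … ]]]`. -/
def nestedCommutator {R : Type*} [Ring R] : (k : ℕ) → (Fin (k + 1) → R) → R
  | 0, X => X 0
  | k + 1, X => ⁅X (Fin.last (k + 1)), nestedCommutator k fun j => X j.castSucc⁆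

/-- `c : {0, …, k} → {1, …, m}` takes each value `l` exactly `α l` times. -/
def IsArrangement {m k : ℕ} (α : Fin m → ℕ) (c : Fin (k + 1) → Fin m) : Prop :=
  ∀ l, (Finset.univ.filter fun j => c j = l).card = α l

/-- Arrangements exist as soon as the multiplicities sum to `k + 1`. -/
theorem exists_isArrangement {m k : ℕ} (α : Fin m → ℕ) (h : ∑ l, α l = k + 1) :
    ∃ c : Fin (k + 1) → Fin m, IsArrangement α c := by
  let e : Fin (k + 1) ≃ (l : Fin m) × Fin (α l) := (finCongr h.symm).trans finSigmaFinEquiv.symm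
  refine ⟨fun j => (e j).1, fun l => ?_⟩
  rw [← Fintype.card_subtype]
  have f : {x : (l : Fin m) × Fin (α l) // x.1 = l} ≃ Fin (α l) :=
    { toFun := fun x => Fin.cast (congrArg α x.2) x.1.2
      invFun := fun i => ⟨⟨l, i⟩, rfl⟩
      left_inv := by rintro ⟨⟨l', i⟩, rfl⟩; rfl
      right_inv := fun i => rfl }
  have g : {j // (e j).1 = l} ≃ {x : (l : Fin m) × Fin (α l) // x.1 = l} :=
    e.subtypeEquiv fun _ => Iff.rfl
  simpa using Fintype.card_congr (g.trans f)

/-- The product formula `∏_q exp(-i τ_q X_{j_q})` given by a list of pairs `(j_q, τ_q)`,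
for Hamiltonians `X_j`; each entry of the list is one exponential. -/
def productFormula {ι κ : Type*} [Fintype κ] [DecidableEq κ] (X : ι → Matrix κ κ ℂ)
    (L : List (ι × ℝ)) : Matrix κ κ ℂ :=
  (L.map fun g => NormedSpace.exp ((-(Complex.I * (g.2 : ℂ))) • X g.1)).prod

/-- The product state `ψ ⊗ φ` of a system and a qubit. -/
def tensorState {n : ℕ} (ψ : EuclideanSpace ℂ (Fin n)) (φ : EuclideanSpace ℂ (Fin 2)) :
    EuclideanSpace ℂ (Fin n × Fin 2) :=
  WithLp.toLp 2 fun x => ψ x.1 * φ x.2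

/-- The ancilla state: the eigenstate `|0⟩` of `σ_z` for odd `k` and the eigenstate
`(|0⟩ + |1⟩) / √2` of `σ_x` for even `k`. -/
def ancilla (k : ℕ) : EuclideanSpace ℂ (Fin 2) :=
  if Odd k then !₂[1, 0] else !₂[(1 / Real.sqrt 2 : ℝ), (1 / Real.sqrt 2 : ℝ)]

/-- The circuit `V` on system and qubit simulates `U` with error at most `ε` when the qubit is
in the state `φ`. -/
def SimulatesWithin {n : ℕ} (V : Matrix (Fin n × Fin 2) (Fin n × Fin 2) ℂ)
    (φ : EuclideanSpace ℂ (Fin 2)) (U : Matrix (Fin n) (Fin n) ℂ) (ε : ℝ) : Prop :=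
  ∀ ψ : EuclideanSpace ℂ (Fin n),
    ‖Matrix.toEuclideanCLM (𝕜 := ℂ) V (tensorState ψ φ) -
        tensorState (Matrix.toEuclideanCLM (𝕜 := ℂ) U ψ) φ‖ ≤ ε * ‖ψ‖

/-- `(6^{pk} Λ t)^{k + 1 + (k+1)²/(2p)} / ε^{(k+1)/(2p)}`. -/
def stepBound (k p : ℕ) (Λ t ε : ℝ) : ℝ :=
  ((6 : ℝ) ^ (p * k) * (Λ * t)) ^ ((k : ℝ) + 1 + ((k : ℝ) + 1) ^ 2 / (2 * (p : ℝ))) /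
    ε ^ (((k : ℝ) + 1) / (2 * (p : ℝ)))

end

/-! Since the `A l` commute, a bracket of dilated operators multiplies the matrix factors and
brackets only the Pauli factors, and bracketing with `σ_y` exchanges `σ_x` and `σ_z` up to a scalar.
The nested commutator is therefore a multiple of `P ⊗ σ`, with the ancilla state fixed by `σ`, so
its exponential acts on the system alone (`nestedCommutator_dilation`, `exp_kronecker_tensorState`).
It remains to simulate the exponential of a nested commutator `X`.

Put `m = k + 1`. The iterated group commutator of the exponentials agrees with `exp (z ^ m X)` up to
`O(z ^ (m + 1))` (`exists_hasJet_nestedCommutator`). Rescaling time by `c` multiplies the main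
exponent by `c ^ m` and an error of order `q` by `c ^ q`; inversion negates both; concatenation adds
both. Two copies cancel the error if `m + q` is odd, three copies whenever `q > m`. One round of
both gains two orders and multiplies the length by 6 (`HasJet.raise_order`). The total time grows
per round by a ratio tending to `6 * 2 ^ (-1 / m) < 6`, so after `p` rounds it is `O(6 ^ p)` with a
constant that depends only on `k` (`exists_prod_timeRatio_le`).

Words are entire functions of a complex time `z`, so the error needs no expansion: the maximum
principle bounds it by `6 (Λ T y) ^ q`, uniformly in `p` (`HasJet.norm_sub_le`). Finally the
evolution is cut into `r` equal segments, whose errors add linearly by unitarity;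
`exists_segment_count` chooses `r`. -/

/-! ### Words of exponentials and their evolution in complex time -/

section ProductWords

variable {ι κ 𝔸 : Type*}

/-- The word of the same exponentials with all times multiplied by `c`. -/
def rescale (c : ℝ) (L : List (ι × ℝ)) : List (ι × ℝ) :=
  L.map fun g => (g.1, c * g.2)

/-- The word of the inverse product. -/
def inverseWord (L : List (ι × ℝ)) : List (ι × ℝ) :=
  (rescale (-1) L).reverse

/-- The sum of the absolute values of the times of a word. -/
def totalTime (L : List (ι × ℝ)) : ℝ :=
  (L.map fun g => |g.2|).sum

@[simp] theorem length_rescale (c : ℝ) (L : List (ι × ℝ)) :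
    (rescale c L).length = L.length := by
  simp [rescale]

@[simp] theorem length_inverseWord (L : List (ι × ℝ)) :
    (inverseWord L).length = L.length := by
  simp [inverseWord]

@[simp] theorem totalTime_append (L M : List (ι × ℝ)) :
    totalTime (L ++ M) = totalTime L + totalTime M := by
  simp [totalTime]

@[simp] theorem totalTime_rescale (c : ℝ) (L : List (ι × ℝ)) :
    totalTime (rescale c L) = |c| * totalTime L := by
  simp [totalTime, rescale, abs_mul, List.sum_map_mul_left, Function.comp_def]

@[simp] theorem totalTime_inverseWord (L : List (ι × ℝ)) :
    totalTime (inverseWord L) = totalTime L := by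
  have h : totalTime (inverseWord L) = totalTime (rescale (-1) L) := by
    simp [totalTime, inverseWord, List.sum_reverse]
  simp [h]

theorem totalTime_nonneg (L : List (ι × ℝ)) : 0 ≤ totalTime L := by
  refine List.sum_nonneg ?_
  simp only [List.mem_map]
  rintro _ ⟨g, -, rfl⟩
  exact abs_nonneg _

variable [NormedRing 𝔸] [NormedAlgebra ℂ 𝔸]

/-- The product of the exponentials `exp (z τ H_j)` over the entries `(j, τ)` of a word. -/
noncomputable def evolve (H : ι → 𝔸) (L : List (ι × ℝ)) (z : ℂ) : 𝔸 :=
  (L.map fun g => NormedSpace.exp ((z * (g.2 : ℂ)) • H g.1)).prod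

@[simp] theorem evolve_nil (H : ι → 𝔸) (z : ℂ) : evolve H [] z = 1 := rfl

theorem evolve_cons (H : ι → 𝔸) (g : ι × ℝ) (L : List (ι × ℝ)) (z : ℂ) :
    evolve H (g :: L) z = NormedSpace.exp ((z * (g.2 : ℂ)) • H g.1) * evolve H L z := by
  simp [evolve]

theorem evolve_append (H : ι → 𝔸) (L M : List (ι × ℝ)) (z : ℂ) :
    evolve H (L ++ M) z = evolve H L z * evolve H M z := by
  simp [evolve]

theorem evolve_rescale (H : ι → 𝔸) (c : ℝ) (L : List (ι × ℝ)) (z : ℂ) :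
    evolve H (rescale c L) z = evolve H L (c * z) := by
  simp only [evolve, rescale, List.map_map, Function.comp_def]
  congr 2
  ext g
  push_cast
  rw [show z * (c * (g.2 : ℂ)) = c * z * g.2 by ring]

theorem evolve_map (H : ι → 𝔸) (f : κ → ι) (L : List (κ × ℝ)) (z : ℂ) :
    evolve H (L.map (Prod.map f id)) z = evolve (fun j => H (f j)) L z := by
  simp [evolve, Function.comp_def]

theorem evolve_flatten_replicate (H : ι → 𝔸) (L : List (ι × ℝ)) (r : ℕ) (z : ℂ) :
    evolve H (List.replicate r L).flatten z = evolve H L z ^ r := by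
  induction r with
  | zero => simp
  | succ r ih => rw [List.replicate_succ, List.flatten_cons, evolve_append, ih, pow_succ']

theorem exp_add_of_commute_complex [CompleteSpace 𝔸] {x y : 𝔸} (h : Commute x y) :
    NormedSpace.exp (x + y) = NormedSpace.exp x * NormedSpace.exp y := by
  let +nondep : NormedAlgebra ℚ 𝔸 := .restrictScalars ℚ ℂ 𝔸
  exact NormedSpace.exp_add_of_commute h

theorem exp_smul_mul_exp_smul [CompleteSpace 𝔸] (a b : ℂ) (x : 𝔸) :
    NormedSpace.exp (a • x) * NormedSpace.exp (b • x) = NormedSpace.exp ((a + b) • x) := by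
  rw [add_smul, exp_add_of_commute_complex]
  exact ((Commute.refl x).smul_left a).smul_right b

theorem evolve_mul_evolve_inverseWord [CompleteSpace 𝔸] (H : ι → 𝔸) (L : List (ι × ℝ)) (z : ℂ) :
    evolve H L z * evolve H (inverseWord L) z = 1 := by
  induction L with
  | nil => simp [inverseWord, rescale]
  | cons g L ih =>
    have h : inverseWord (g :: L) = inverseWord L ++ [(g.1, -g.2)] := by
      simp [inverseWord, rescale]
    rw [h, evolve_append, evolve_cons, mul_assoc, ← mul_assoc (evolve H L z), ih, one_mul,
      evolve_cons, evolve_nil, mul_one, exp_smul_mul_exp_smul]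
    simp

theorem differentiable_exp [CompleteSpace 𝔸] : Differentiable ℂ (NormedSpace.exp : 𝔸 → 𝔸) :=
  fun x => (NormedSpace.exp_analytic (𝕂 := ℂ) x).differentiableAt

theorem differentiable_evolve [CompleteSpace 𝔸] (H : ι → 𝔸) (L : List (ι × ℝ)) :
    Differentiable ℂ (evolve H L) := by
  induction L with
  | nil => exact differentiable_const (1 : 𝔸)
  | cons g L ih =>
    have h : evolve H (g :: L) =
        fun z => NormedSpace.exp ((z * (g.2 : ℂ)) • H g.1) * evolve H L z := by
      ext z
      exact evolve_cons H g L z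
    rw [h]
    refine Differentiable.mul (differentiable_exp.comp ?_) ih
    fun_prop

theorem norm_exp_le_complex [NormOneClass 𝔸] [CompleteSpace 𝔸] (x : 𝔸) :
    ‖NormedSpace.exp x‖ ≤ Real.exp ‖x‖ := by
  have h := NormedSpace.exp_series_hasSum_exp' (𝕂 := ℂ) x
  have h' := NormedSpace.exp_series_hasSum_exp' (𝕂 := ℝ) ‖x‖
  rw [← Real.exp_eq_exp_ℝ] at h'
  refine h.norm_le_of_bounded h' fun n => ?_
  rw [norm_smul, smul_eq_mul, norm_inv, Complex.norm_natCast]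
  gcongr
  exact norm_pow_le x n

/-- Only the total time enters, not the number of exponentials; this is why total times are tracked
separately from lengths. -/
theorem norm_evolve_le [NormOneClass 𝔸] [CompleteSpace 𝔸] {H : ι → 𝔸} {h : ℝ}
    (hH : ∀ j, ‖H j‖ ≤ h) (L : List (ι × ℝ)) (z : ℂ) :
    ‖evolve H L z‖ ≤ Real.exp (‖z‖ * h * totalTime L) := by
  induction L with
  | nil => simp [totalTime]
  | cons g L ih =>
    rw [evolve_cons]
    have e : totalTime (g :: L) = |g.2| + totalTime L := by simp [totalTime]
    rw [e, mul_add, Real.exp_add]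
    refine (norm_mul_le _ _).trans (mul_le_mul ?_ ih (norm_nonneg _) (Real.exp_nonneg _))
    refine (norm_exp_le_complex _).trans (Real.exp_le_exp.2 ?_)
    rw [norm_smul, norm_mul, Complex.norm_real, Real.norm_eq_abs]
    nlinarith [mul_le_mul_of_nonneg_left (hH g.1) (mul_nonneg (norm_nonneg z) (abs_nonneg g.2))]

end ProductWords

/-! ### Maximum principle for entire functions -/

section EntireFunctions

variable {E : Type*} [NormedAddCommGroup E] [NormedSpace ℂ E]

theorem differentiable_dslope [CompleteSpace E] {f : ℂ → E} (hf : Differentiable ℂ f) (c : ℂ) :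
    Differentiable ℂ (dslope f c) :=
  differentiableOn_univ.1
    ((Complex.differentiableOn_dslope Filter.univ_mem).2 hf.differentiableOn)

/-- Cauchy's estimate for the cofactor of a zero of order `q`. -/
theorem norm_le_of_norm_pow_smul_le {g : ℂ → E} (hg : Differentiable ℂ g) {q : ℕ} {R M : ℝ}
    (hR : 0 < R) (hM : ∀ z : ℂ, ‖z‖ = R → ‖z ^ q • g z‖ ≤ M) {z : ℂ} (hz : ‖z‖ ≤ R) :
    ‖g z‖ ≤ M / R ^ q := by
  refine Complex.norm_le_of_forall_mem_frontier_norm_le (U := Metric.ball (0 : ℂ) R)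
    Metric.isBounded_ball hg.diffContOnCl (fun w hw => ?_) ?_
  · rw [frontier_ball _ hR.ne', mem_sphere_zero_iff_norm] at hw
    rw [le_div_iff₀ (by positivity), mul_comm]
    simpa [norm_smul, hw] using hM w hw
  · rw [closure_ball _ hR.ne', mem_closedBall_zero_iff]
    exact hz

end EntireFunctions

/-! ### Leading errors of words and their cancellation -/

section Jets

variable {ι κ 𝔸 : Type*} [NormedRing 𝔸] [NormedAlgebra ℂ 𝔸]

/-- `∏ exp (z τ H_j) = exp (a z ^ m X) + e z ^ q + O(z ^ (q + 1))` as `z → 0`. -/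
def HasJet (m q : ℕ) (X : 𝔸) (H : ι → 𝔸) (L : List (ι × ℝ)) (a : ℝ) (e : 𝔸) : Prop :=
  ∃ E : ℂ → 𝔸, Differentiable ℂ E ∧ E 0 = e ∧
    ∀ z, evolve H L z = NormedSpace.exp (((a : ℂ) * z ^ m) • X) + z ^ q • E z

variable {m q : ℕ} {X : 𝔸} {H : ι → 𝔸} {L M : List (ι × ℝ)} {a b : ℝ} {e f : 𝔸}

theorem differentiable_exp_pow_smul [CompleteSpace 𝔸] (a : ℂ) (m : ℕ) (X : 𝔸) :
    Differentiable ℂ fun z : ℂ => NormedSpace.exp ((a * z ^ m) • X) :=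
  differentiable_exp.comp (by fun_prop)

/-- The two main exponentials commute, so they combine exactly. All other factors equal `1` at `z =
0`, so the leading errors simply add. -/
theorem HasJet.append [CompleteSpace 𝔸] (hm : 0 < m) (hq : 0 < q) (hL : HasJet m q X H L a e)
    (hM : HasJet m q X H M b f) : HasJet m q X H (L ++ M) (a + b) (e + f) := by
  obtain ⟨E, hE, hE0, hLE⟩ := hL
  obtain ⟨F, hF, hF0, hMF⟩ := hM
  refine ⟨fun z => E z * evolve H M z + NormedSpace.exp (((a : ℂ) * z ^ m) • X) * F z, ?_, ?_, ?_⟩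
  · exact (hE.mul (differentiable_evolve H M)).add ((differentiable_exp_pow_smul _ _ _).mul hF)
  · simp [hMF, hE0, hF0, hm.ne', hq.ne']
  · intro z
    rw [evolve_append, hLE z, add_mul, smul_mul_assoc, smul_add]
    nth_rewrite 1 [hMF z]
    rw [mul_add, exp_smul_mul_exp_smul, mul_smul_comm, ← add_mul, Complex.ofReal_add]
    abel

theorem HasJet.inverseWord [CompleteSpace 𝔸] (hm : 0 < m) (hq : 0 < q)
    (hL : HasJet m q X H L a e) : HasJet m q X H (inverseWord L) (-a) (-e) := by
  obtain ⟨E, hE, hE0, hLE⟩ := hL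
  refine ⟨fun z => -(NormedSpace.exp (((-a : ℝ) * z ^ m : ℂ) • X) * E z *
    evolve H (_root_.inverseWord L) z), ?_, ?_, ?_⟩
  · exact (((differentiable_exp_pow_smul _ _ _).mul hE).mul (differentiable_evolve H _)).neg
  · have h := evolve_mul_evolve_inverseWord H L 0
    rw [hLE 0] at h
    simp only [ne_eq, hm.ne', not_false_eq_true, zero_pow, mul_zero, zero_smul,
      NormedSpace.exp_zero, hq.ne', add_zero, one_mul] at h ⊢
    rw [h, hE0, mul_one]
  · intro z
    have h1 : NormedSpace.exp (((-a : ℝ) * z ^ m : ℂ) • X) *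
        NormedSpace.exp (((a : ℂ) * z ^ m) • X) = 1 := by
      rw [exp_smul_mul_exp_smul]
      simp
    have h2 := evolve_mul_evolve_inverseWord H L z
    calc evolve H (_root_.inverseWord L) z
        = NormedSpace.exp (((-a : ℝ) * z ^ m : ℂ) • X) *
          ((evolve H L z - z ^ q • E z) * evolve H (_root_.inverseWord L) z) := by
          rw [hLE z, add_sub_cancel_right, ← mul_assoc, h1, one_mul]
      _ = _ := by
          rw [sub_mul, h2, mul_sub, mul_one]
          simp only [smul_neg, mul_smul_comm, smul_mul_assoc, mul_assoc, sub_eq_add_neg]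

theorem HasJet.rescale (c : ℝ) (hL : HasJet m q X H L a e) :
    HasJet m q X H (rescale c L) (c ^ m * a) ((c ^ q : ℂ) • e) := by
  obtain ⟨E, hE, hE0, hLE⟩ := hL
  refine ⟨fun z => (c ^ q : ℂ) • E (c * z), ?_, by simp [hE0], fun z => ?_⟩
  · exact (hE.comp (by fun_prop : Differentiable ℂ fun z : ℂ => (c : ℂ) * z)).const_smul
      ((c : ℂ) ^ q)
  · rw [evolve_rescale, hLE, smul_smul, mul_pow, mul_pow, mul_comm (z ^ q)]
    push_cast
    rw [show (a : ℂ) * (c ^ m * z ^ m) = c ^ m * a * z ^ m by ring]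

/-- An entire cofactor that vanishes at `0` is divisible by `z`. -/
theorem HasJet.succ [CompleteSpace 𝔸] (hL : HasJet m q X H L a 0) :
    ∃ e, HasJet m (q + 1) X H L a e := by
  obtain ⟨E, hE, hE0, hLE⟩ := hL
  refine ⟨_, dslope E 0, differentiable_dslope hE 0, rfl, fun z => ?_⟩
  rw [hLE, pow_succ, mul_smul (z ^ q)]
  have h : E z = z • dslope E 0 z := by
    simpa [hE0] using (sub_smul_dslope E 0 z).symm
  rw [← h]

/-- A product of two rescaled copies cancels an error of order `q` if `m + q` is odd. -/
theorem HasJet.cancel_two [CompleteSpace 𝔸] (hm : 0 < m) (hq : 0 < q) (hmq : Odd (m + q)) {μ : ℝ}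
    (hμ : 2 * μ ^ m = 1) (hL : HasJet m q X H L 1 e) :
    ∃ M : List (ι × ℝ), M.length = 2 * L.length ∧ totalTime M = 2 * |μ| * totalTime L ∧
      ∃ f, HasJet m (q + 1) X H M 1 f := by
  -- Reversing time multiplies the main exponent by `(-1) ^ m` and the error by `(-1) ^ q`;
  -- inversion negates both. As the parities differ, reversal (`m` even) or reversal with inversion
  -- (`m` odd) keeps the main term and flips the error.
  rcases Nat.even_or_odd m with h | h
  · have hq' : Odd q := by
      rcases Nat.even_or_odd q with h' | h'
      · exact absurd (h.add h') (Nat.not_even_iff_odd.2 hmq)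
      · exact h'
    have h' := (hL.rescale μ).append hm hq (hL.rescale (-μ))
    refine ⟨_root_.rescale μ L ++ _root_.rescale (-μ) L, ?_, ?_, ?_⟩
    · simp [two_mul]
    · simp only [totalTime_append, totalTime_rescale, abs_neg]
      ring
    · have h1 : μ ^ m * 1 + (-μ) ^ m * 1 = 1 := by
        rw [h.neg_pow]
        linarith
      have h2 : ((μ : ℂ) ^ q) • e + (((-μ : ℝ) : ℂ) ^ q) • e = 0 := by
        rw [Complex.ofReal_neg, hq'.neg_pow, neg_smul, add_neg_cancel]
      rw [h1, h2] at h'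
      exact h'.succ
  · have hq' : Even q := by
      rcases Nat.even_or_odd q with h' | h'
      · exact h'
      · exact absurd (h.add_odd h') (Nat.not_even_iff_odd.2 hmq)
    have h' := (hL.rescale μ).append hm hq ((hL.rescale (-μ)).inverseWord hm hq)
    refine ⟨_root_.rescale μ L ++ _root_.inverseWord (_root_.rescale (-μ) L), ?_, ?_, ?_⟩
    · simp [two_mul]
    · simp only [totalTime_append, totalTime_rescale, totalTime_inverseWord, abs_neg]
      ring
    · have h1 : μ ^ m * 1 + -((-μ) ^ m * 1) = 1 := by
        rw [h.neg_pow]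
        linarith
      have h2 : ((μ : ℂ) ^ q) • e + -((((-μ : ℝ) : ℂ) ^ q) • e) = 0 := by
        rw [Complex.ofReal_neg, hq'.neg_pow, add_neg_cancel]
      rw [h1, h2] at h'
      exact h'.succ

/-- A product of three rescaled copies, the middle one inverted, cancels an error of order `q`. -/
theorem HasJet.cancel_three [CompleteSpace 𝔸] (hm : 0 < m) (hq : 0 < q) {α β : ℝ}
    (h1 : 2 * α ^ m - β ^ m = 1) (h2 : 2 * α ^ q = β ^ q) (hL : HasJet m q X H L 1 e) :
    ∃ M : List (ι × ℝ), M.length = 3 * L.length ∧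
      totalTime M = (2 * |α| + |β|) * totalTime L ∧ ∃ f, HasJet m (q + 1) X H M 1 f := by
  have h := ((hL.rescale α).append hm hq ((hL.rescale β).inverseWord hm hq)).append hm hq
    (hL.rescale α)
  refine ⟨_root_.rescale α L ++ _root_.inverseWord (_root_.rescale β L) ++ _root_.rescale α L,
    ?_, ?_, ?_⟩
  · simp only [List.length_append, length_rescale, length_inverseWord]
    ring
  · simp only [totalTime_append, totalTime_rescale, totalTime_inverseWord]
    ring
  · have h1' : α ^ m * 1 + -(β ^ m * 1) + α ^ m * 1 = 1 := by linarith
    have h2' : ((α : ℂ) ^ q) • e + -(((β : ℂ) ^ q) • e) + ((α : ℂ) ^ q) • e = 0 := by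
      have h3 : (β : ℂ) ^ q = 2 * (α : ℂ) ^ q := by exact_mod_cast h2.symm
      rw [h3, two_mul, add_smul]
      abel
    rw [h1', h2'] at h
    exact h.succ

/-- The word of the iterated group commutator of the exponentials generated by `H_0, …, H_k`. -/
theorem exists_word_nestedCommutator [CompleteSpace 𝔸] (k : ℕ) (H : Fin (k + 1) → 𝔸) :
    ∃ L : List (Fin (k + 1) × ℝ), L.length + 2 = 3 * 2 ^ k ∧ totalTime L + 2 = 3 * 2 ^ k ∧
      ∃ E : ℂ → 𝔸, Differentiable ℂ E ∧ E 0 = nestedCommutator k H ∧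
        ∀ z, evolve H L z = 1 + z ^ (k + 1) • E z := by
  have key : ∀ x : 𝔸, ∃ E : ℂ → 𝔸, Differentiable ℂ E ∧ E 0 = x ∧
      ∀ z : ℂ, NormedSpace.exp (z • x) = 1 + z • E z := by
    intro x
    have hd : Differentiable ℂ fun z : ℂ => NormedSpace.exp (z • x) :=
      differentiable_exp.comp (by fun_prop)
    refine ⟨dslope (fun z : ℂ => NormedSpace.exp (z • x)) 0, differentiable_dslope hd 0, ?_, ?_⟩
    · rw [dslope_same]
      simpa using (hasDerivAt_exp_smul_const (𝕂 := ℂ) x (0 : ℂ)).deriv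
    · intro z
      have h := sub_smul_dslope (fun z : ℂ => NormedSpace.exp (z • x)) 0 z
      simp only [sub_zero, zero_smul, NormedSpace.exp_zero] at h
      rw [h]
      abel
  induction k with
  | zero =>
    obtain ⟨E, hE, hE0, h⟩ := key (H 0)
    refine ⟨[(0, 1)], by simp, by norm_num [totalTime], E, hE, hE0, fun z => ?_⟩
    simp [evolve, h]
  | succ k ih =>
    obtain ⟨L, hlen, htime, E, hE, hE0, hLE⟩ := ih fun j => H j.castSucc
    obtain ⟨F, hF, hF0, h⟩ := key (H (Fin.last (k + 1)))
    set K : List (Fin (k + 2) × ℝ) := L.map (Prod.map Fin.castSucc id) with hK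
    have hKL : ∀ z, evolve H K z = 1 + z ^ (k + 1) • E z := fun z => by
      rw [hK, evolve_map, hLE]
    have hlenK : K.length = L.length := by simp [hK]
    have htimeK : totalTime K = totalTime L := by simp [hK, totalTime, Function.comp_def]
    set x := H (Fin.last (k + 1)) with hx
    set W : List (Fin (k + 2) × ℝ) :=
      [(Fin.last (k + 1), 1)] ++ K ++ [(Fin.last (k + 1), -1)] ++ inverseWord K with hW
    have hlast : ∀ (s : ℝ) (z : ℂ),
        evolve H [(Fin.last (k + 1), s)] z = NormedSpace.exp ((z * s) • x) := by
      intro s z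
      simp [evolve, hx]
    refine ⟨W, ?_, ?_, fun z => (F z * E z - E z * F z) * NormedSpace.exp ((-z) • x) *
      evolve H (inverseWord K) z, ?_, ?_, ?_⟩
    -- The new length is `2 * L.length + 2`, so length plus 2 doubles; the total time obeys the same
    -- recursion.
    · simp only [hW, List.length_append, length_inverseWord, List.length_singleton, hlenK]
      rw [pow_succ]
      omega
    · simp only [hW, totalTime_append, totalTime_inverseWord, htimeK]
      have h1 : ∀ s : ℝ, totalTime [(Fin.last (k + 1), s)] = |s| := by simp [totalTime]
      rw [h1, h1, pow_succ]
      norm_num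
      linarith
    · refine ((((hF.mul hE).sub (hE.mul hF)).mul ?_).mul (differentiable_evolve H _))
      exact differentiable_exp.comp (by fun_prop)
    · have h0 := evolve_mul_evolve_inverseWord H K 0
      rw [hKL 0] at h0
      simp only [ne_eq, Nat.succ_ne_zero, not_false_eq_true, zero_pow, zero_smul, add_zero,
        one_mul] at h0
      simp only [neg_zero, zero_smul, NormedSpace.exp_zero, mul_one, h0, hF0, hE0]
      rfl
    · intro z
      have hi := evolve_mul_evolve_inverseWord H K z
      have hs : NormedSpace.exp (z • x) * NormedSpace.exp ((-z) • x) = 1 := by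
        rw [exp_smul_mul_exp_smul]
        simp
      -- Only the parts beyond the identity fail to commute, and their commutator carries the factor
      -- `z * z ^ (k + 1)`.
      have hc : NormedSpace.exp (z • x) * evolve H K z =
          evolve H K z * NormedSpace.exp (z • x) + z ^ (k + 2) • (F z * E z - E z * F z) := by
        rw [h z, hKL z, pow_succ' z (k + 1)]
        simp only [add_mul, mul_add, one_mul, mul_one, smul_mul_assoc, mul_smul_comm, smul_sub,
          smul_add, smul_smul]
        rw [mul_comm (z ^ (k + 1)) z]
        abel
      rw [hW, evolve_append, evolve_append, evolve_append, hlast, hlast, Complex.ofReal_one,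
        mul_one, hc]
      push_cast
      rw [mul_neg, mul_one, add_mul, add_mul, mul_assoc (evolve H K z), hs, mul_one, hi]
      simp only [smul_mul_assoc]

/-- The word and `exp (z ^ (k + 1) X)` are both `1 + z ^ (k + 1) X` to leading order, so the error
of order `k + 1` vanishes and `HasJet.succ` applies. -/
theorem exists_hasJet_nestedCommutator [CompleteSpace 𝔸] (k : ℕ) (H : Fin (k + 1) → 𝔸) :
    ∃ L : List (Fin (k + 1) × ℝ), L.length ≤ 3 * 2 ^ k ∧ totalTime L ≤ 3 * 2 ^ k ∧
      ∃ e, HasJet (k + 1) (k + 2) (nestedCommutator k H) H L 1 e := by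
  obtain ⟨L, hlen, htime, E, hE, hE0, hLE⟩ := exists_word_nestedCommutator k H
  refine ⟨L, by omega, by linarith, ?_⟩
  set X := nestedCommutator k H
  have hd : Differentiable ℂ fun z : ℂ => NormedSpace.exp (z • X) :=
    differentiable_exp.comp (by fun_prop)
  set D := dslope (fun z : ℂ => NormedSpace.exp (z • X)) 0
  have hD : Differentiable ℂ D := differentiable_dslope hd 0
  refine HasJet.succ ⟨fun z => E z - D (z ^ (k + 1)), ?_, ?_, fun z => ?_⟩
  · exact hE.sub (hD.comp (by fun_prop : Differentiable ℂ fun z : ℂ => z ^ (k + 1)))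
  · have h0 : D 0 = X := by
      simp only [D, dslope_same]
      simpa using (hasDerivAt_exp_smul_const (𝕂 := ℂ) X (0 : ℂ)).deriv
    simp [h0, hE0, X]
  · have h := sub_smul_dslope (fun z : ℂ => NormedSpace.exp (z • X)) 0 (z ^ (k + 1))
    simp only [sub_zero, zero_smul, NormedSpace.exp_zero] at h
    rw [hLE, smul_sub, h, Complex.ofReal_one, one_mul]
    abel

end Jets

/-! ### Raising the order, growth of total time, error bound -/

section OrderRaising

open Filter Topology

/-- The ratio of total times in one round of order raising: a twofold product at order `q - 1`
followed by a threefold product at order `q`. -/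
noncomputable def timeRatio (m q : ℕ) : ℝ :=
  (2 * (1 / 2 : ℝ) ^ (1 / m : ℝ)) *
    ((2 + (2 : ℝ) ^ (1 / q : ℝ)) * (2 - (2 : ℝ) ^ (m / q : ℝ))⁻¹ ^ (1 / m : ℝ))

theorem tendsto_timeRatio (m : ℕ) :
    Tendsto (timeRatio m) atTop (𝓝 (2 * (1 / 2 : ℝ) ^ (1 / m : ℝ) * 3)) := by
  have h1 : Tendsto (fun q : ℕ => (2 : ℝ) ^ (1 / q : ℝ)) atTop (𝓝 1) := by
    have := (tendsto_const_nhds (x := (2 : ℝ))).rpow (tendsto_const_div_atTop_nhds_zero_nat 1)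
      (Or.inl two_ne_zero)
    simpa using this
  have h2 : Tendsto (fun q : ℕ => (2 : ℝ) ^ (m / q : ℝ)) atTop (𝓝 1) := by
    have := (tendsto_const_nhds (x := (2 : ℝ))).rpow
      (tendsto_const_div_atTop_nhds_zero_nat (m : ℝ)) (Or.inl two_ne_zero)
    simpa using this
  have h3 : Tendsto (fun q : ℕ => (2 - (2 : ℝ) ^ (m / q : ℝ))⁻¹ ^ (1 / m : ℝ)) atTop (𝓝 1) := by
    have := ((tendsto_const_nhds (x := (2 : ℝ))).sub h2).inv₀ (by norm_num)
    have h := this.rpow_const (p := (1 / m : ℝ)) (Or.inl (by norm_num))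
    norm_num at h ⊢
    exact h
  have h := ((h1.const_add 2).mul h3).const_mul (2 * (1 / 2 : ℝ) ^ (1 / m : ℝ))
  rw [mul_one] at h
  norm_num only at h ⊢
  exact h

theorem two_rpow_div_lt_two {m q : ℕ} (hq : m < q) : (2 : ℝ) ^ (m / q : ℝ) < 2 := by
  have h : (m / q : ℝ) < 1 := by
    rw [div_lt_one (by exact_mod_cast (Nat.zero_le m).trans_lt hq)]
    exact_mod_cast hq
  simpa using Real.rpow_lt_rpow_of_exponent_lt one_lt_two h

theorem timeRatio_nonneg {m q : ℕ} (hq : m < q) : 0 ≤ timeRatio m q := by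
  have := two_rpow_div_lt_two hq
  have : 0 ≤ (2 - (2 : ℝ) ^ (m / q : ℝ))⁻¹ := inv_nonneg.2 (by linarith)
  unfold timeRatio
  positivity

/-- The limit of the ratios is strictly below 6, so the products divided by `6 ^ p` eventually
decrease. -/
theorem exists_prod_timeRatio_le {m : ℕ} (hm : 0 < m) :
    ∃ C : ℝ, ∀ p : ℕ, ∏ i ∈ Finset.range p, timeRatio m (m + 2 + 2 * i) ≤ C * 6 ^ p := by
  have hlt : 2 * (1 / 2 : ℝ) ^ (1 / m : ℝ) * 3 < 6 := by
    have : (1 / 2 : ℝ) ^ (1 / m : ℝ) < 1 :=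
      Real.rpow_lt_one (by norm_num) (by norm_num) (by positivity)
    linarith
  have hsub : Tendsto (fun i : ℕ => m + 2 + 2 * i) atTop atTop :=
    tendsto_atTop_mono (fun i => by simp only [id]; omega) tendsto_id
  obtain ⟨n, hn⟩ := eventually_atTop.1 (((tendsto_timeRatio m).comp hsub).eventually_lt_const hlt)
  set b : ℕ → ℝ := fun p => ∏ i ∈ Finset.range p, timeRatio m (m + 2 + 2 * i) with hb
  have hb0 : ∀ p, 0 ≤ b p := fun p =>
    Finset.prod_nonneg fun i _ => timeRatio_nonneg (by omega)
  -- The sum of the nonnegative initial terms serves as a bound for their maximum.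
  refine ⟨∑ i ∈ Finset.range (n + 1), b i / 6 ^ i, fun p => ?_⟩
  rw [← div_le_iff₀ (by positivity)]
  change b p / 6 ^ p ≤ _
  rcases le_total p n with h | h
  · exact Finset.single_le_sum (f := fun i => b i / 6 ^ i)
      (fun i _ => div_nonneg (hb0 i) (by positivity)) (Finset.mem_range.2 (by omega))
  · induction p, h using Nat.le_induction with
    | base =>
      exact Finset.single_le_sum (f := fun i => b i / 6 ^ i)
        (fun i _ => div_nonneg (hb0 i) (by positivity)) (Finset.mem_range.2 (by omega))
    | succ p hp ih =>
      refine le_trans ?_ ih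
      have h1 : b (p + 1) ≤ b p * 6 := by
        simp only [hb, Finset.prod_range_succ]
        exact mul_le_mul_of_nonneg_left (hn p hp).le (hb0 p)
      rw [pow_succ, div_le_div_iff₀ (by positivity) (by positivity)]
      nlinarith [mul_le_mul_of_nonneg_right h1 (by positivity : (0 : ℝ) ≤ 6 ^ p)]

variable {ι 𝔸 : Type*} [NormedRing 𝔸] [NormedAlgebra ℂ 𝔸] [CompleteSpace 𝔸]
  {m q : ℕ} {X : 𝔸} {H : ι → 𝔸} {L : List (ι × ℝ)} {e : 𝔸}

/-- The coefficient `-1` produced by inversion is absorbed into the generator. -/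
theorem HasJet.neg (hm : 0 < m) (hq : 0 < q) (hL : HasJet m q X H L 1 e) :
    ∃ f, HasJet m q (-X) H (_root_.inverseWord L) 1 f := by
  obtain ⟨E, hE, -, h⟩ := hL.inverseWord hm hq
  exact ⟨_, E, hE, rfl, fun z => by simpa using h z⟩

theorem HasJet.raise_order (hm : 0 < m) (hq : m ≤ q) (hmq : Odd (m + q))
    (hL : HasJet m q X H L 1 e) :
    ∃ M : List (ι × ℝ), M.length = 6 * L.length ∧
      totalTime M = timeRatio m (q + 1) * totalTime L ∧ ∃ f, HasJet m (q + 2) X H M 1 f := by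
  have root : ∀ {x : ℝ} {n : ℕ}, 0 < n → 0 ≤ x → (x ^ (1 / n : ℝ)) ^ n = x := by
    intro x n hn hx
    rw [one_div, Real.rpow_inv_natCast_pow hx hn.ne']
  obtain ⟨M, hM, hMt, f, hf⟩ := hL.cancel_two hm (hm.trans_le hq) hmq
    (μ := (1 / 2 : ℝ) ^ (1 / m : ℝ)) (by rw [root hm (by norm_num)]; norm_num)
  have hlt : (2 : ℝ) ^ (m / (q + 1 : ℕ) : ℝ) < 2 := two_rpow_div_lt_two (by omega)
  -- With `β = γ * α`, the condition at order `q + 1` forces `γ ^ (q + 1) = 2`, and the main term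
  -- then requires `(2 - γ ^ m) * α ^ m = 1`, solvable because `m < q + 1`.
  set α : ℝ := (2 - (2 : ℝ) ^ (m / (q + 1 : ℕ) : ℝ))⁻¹ ^ (1 / m : ℝ) with hα
  set γ : ℝ := (2 : ℝ) ^ (1 / (q + 1 : ℕ) : ℝ) with hγ
  have hpos : 0 < 2 - (2 : ℝ) ^ (m / (q + 1 : ℕ) : ℝ) := by linarith
  have hα0 : 0 ≤ α := Real.rpow_nonneg (inv_nonneg.2 hpos.le) _
  have hγ0 : 0 ≤ γ := Real.rpow_nonneg zero_le_two _
  have hαm : α ^ m = (2 - (2 : ℝ) ^ (m / (q + 1 : ℕ) : ℝ))⁻¹ := root hm (inv_nonneg.2 hpos.le)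
  have hγm : γ ^ m = (2 : ℝ) ^ (m / (q + 1 : ℕ) : ℝ) := by
    rw [hγ, ← Real.rpow_natCast, ← Real.rpow_mul zero_le_two, one_div_mul_eq_div]
  have hγq : γ ^ (q + 1) = 2 := root (Nat.succ_pos q) zero_le_two
  obtain ⟨N, hN, hNt, g, hg⟩ := hf.cancel_three hm (Nat.succ_pos q) (α := α) (β := γ * α)
    (by rw [mul_pow, hγm, ← sub_mul, hαm, mul_inv_cancel₀ hpos.ne'])
    (by rw [mul_pow, hγq])
  refine ⟨N, by rw [hN, hM]; ring, ?_, g, hg⟩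
  rw [hNt, hMt, abs_of_nonneg hα0, abs_of_nonneg (mul_nonneg hγ0 hα0),
    abs_of_nonneg (Real.rpow_nonneg (by norm_num) _), timeRatio, ← hα, ← hγ]
  ring

theorem HasJet.iterate_raise_order (hm : 0 < m) (hL : HasJet m (m + 1) X H L 1 e) (p : ℕ) :
    ∃ M : List (ι × ℝ), M.length = 6 ^ p * L.length ∧
      totalTime M = (∏ i ∈ Finset.range p, timeRatio m (m + 2 + 2 * i)) * totalTime L ∧
      ∃ f, HasJet m (m + 1 + 2 * p) X H M 1 f := by
  induction p with
  | zero => exact ⟨L, by simp, by simp, e, hL⟩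
  | succ p ih =>
    obtain ⟨M, hM, hMt, f, hf⟩ := ih
    obtain ⟨N, hN, hNt, g, hg⟩ := hf.raise_order hm (by omega) ⟨m + p, by ring⟩
    refine ⟨N, by rw [hN, hM]; ring, ?_, g, hg⟩
    rw [hNt, hMt, Finset.prod_range_succ, show m + 1 + 2 * p + 1 = m + 2 + 2 * p by ring]
    ring

/-- On the circle of radius `(Λ * T)⁻¹` the word and the target are each bounded by `e`, and `2 * e
< 6`. The maximum principle carries the bound on the cofactor inwards. -/
theorem HasJet.norm_sub_le [NormOneClass 𝔸] (hL : HasJet m q X H L 1 e) {Λ T : ℝ}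
    (hΛ : 0 < Λ) (hT : 1 ≤ T) (hH : ∀ j, ‖H j‖ ≤ Λ) (hX : ‖X‖ ≤ Λ ^ m) (hLT : totalTime L ≤ T)
    {y : ℝ} (hy : 0 ≤ y) (hyT : Λ * T * y ≤ 1) :
    ‖evolve H L y - NormedSpace.exp (((y : ℂ) ^ m) • X)‖ ≤ 6 * (Λ * T * y) ^ q := by
  obtain ⟨E, hE, -, h⟩ := hL
  have hT0 : 0 < T := by linarith
  have hR : 0 < (Λ * T)⁻¹ := by positivity
  have hM : ∀ z : ℂ, ‖z‖ = (Λ * T)⁻¹ → ‖z ^ q • E z‖ ≤ 6 := by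
    intro z hz
    have e1 : z ^ q • E z = evolve H L z - NormedSpace.exp ((z ^ m) • X) := by simp [h]
    rw [e1]
    have h1 : ‖evolve H L z‖ ≤ Real.exp 1 := by
      refine (norm_evolve_le hH L z).trans (Real.exp_le_exp.2 ?_)
      calc ‖z‖ * Λ * totalTime L ≤ ‖z‖ * Λ * T := by gcongr
        _ = 1 := by rw [hz]; field_simp
    have h2 : ‖NormedSpace.exp ((z ^ m) • X)‖ ≤ Real.exp 1 := by
      refine (norm_exp_le_complex _).trans (Real.exp_le_exp.2 ?_)
      rw [norm_smul, norm_pow, hz]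
      calc (Λ * T)⁻¹ ^ m * ‖X‖ ≤ (Λ * T)⁻¹ ^ m * Λ ^ m := by gcongr
        _ = (T⁻¹) ^ m := by rw [← mul_pow]; congr 1; field_simp
        _ ≤ 1 := pow_le_one₀ (by positivity) (inv_le_one_of_one_le₀ hT)
    have h3 := Real.exp_one_lt_d9
    linarith [_root_.norm_sub_le (evolve H L z) (NormedSpace.exp ((z ^ m) • X))]
  have hyR : ‖(y : ℂ)‖ ≤ (Λ * T)⁻¹ := by
    rw [Complex.norm_real, Real.norm_of_nonneg hy, ← one_div, le_div_iff₀ (by positivity)]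
    linarith
  have hE' := norm_le_of_norm_pow_smul_le hE hR hM hyR
  have e2 : evolve H L y - NormedSpace.exp (((y : ℂ) ^ m) • X) = (y : ℂ) ^ q • E y := by simp [h]
  rw [e2, norm_smul, norm_pow, Complex.norm_real, Real.norm_of_nonneg hy]
  calc y ^ q * ‖E y‖ ≤ y ^ q * (6 / (Λ * T)⁻¹ ^ q) := by gcongr
    _ = 6 * (Λ * T * y) ^ q := by
      rw [inv_pow, div_inv_eq_mul, mul_pow (Λ * T)]
      ring

end OrderRaising

/-! ### Norm bounds for powers and nested commutators -/

theorem norm_pow_sub_pow_le_mul {𝔸 : Type*} [NormedRing 𝔸] [NormOneClass 𝔸] {a b : 𝔸}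
    (ha : ‖a‖ ≤ 1) (hb : ‖b‖ ≤ 1) (r : ℕ) : ‖a ^ r - b ^ r‖ ≤ r * ‖a - b‖ := by
  induction r with
  | zero => simp
  | succ r ih =>
    have e : a ^ (r + 1) - b ^ (r + 1) = (a ^ r - b ^ r) * a + b ^ r * (a - b) := by
      rw [pow_succ, pow_succ]
      noncomm_ring
    have hb' : ‖b ^ r‖ ≤ 1 := (norm_pow_le b r).trans (pow_le_one₀ (norm_nonneg _) hb)
    rw [e]
    refine (norm_add_le _ _).trans ?_
    have h1 := (norm_mul_le (a ^ r - b ^ r) a).trans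
      (mul_le_of_le_one_right (norm_nonneg _) ha)
    have h2 := (norm_mul_le (b ^ r) (a - b)).trans
      (mul_le_of_le_one_left (norm_nonneg _) hb')
    push_cast
    linarith

/-- One factor 2 more than necessary, so that with `Λ = 2 * h` the bound is exactly the `Λ ^ m`
required by `HasJet.norm_sub_le`. -/
theorem norm_nestedCommutator_le {𝔸 : Type*} [NormedRing 𝔸] {h : ℝ} (hh : 0 ≤ h) :
    ∀ (k : ℕ) (H : Fin (k + 1) → 𝔸), (∀ j, ‖H j‖ ≤ h) →
      ‖nestedCommutator k H‖ ≤ (2 * h) ^ (k + 1)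
  | 0, H, hH => by
    simp only [nestedCommutator, zero_add, pow_one]
    linarith [hH 0]
  | k + 1, H, hH => by
    have ih := norm_nestedCommutator_le hh k (fun j => H j.castSucc) fun j => hH _
    set N := nestedCommutator k fun j => H j.castSucc
    have h0 := hH (Fin.last (k + 1))
    have h1 := norm_mul_le (H (Fin.last (k + 1))) N
    have h2 := norm_mul_le N (H (Fin.last (k + 1)))
    have h3 := mul_le_mul h0 ih (norm_nonneg _) hh
    rw [nestedCommutator, Ring.lie_def, pow_succ]
    refine (norm_sub_le _ _).trans ?_
    nlinarith

/-! ### Dilated operators, Pauli algebra and the ancilla -/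

section Dilation

variable {n : ℕ}

theorem commutator_kronecker {A B : Matrix (Fin n) (Fin n) ℂ} (h : Commute A B)
    (σ τ : Matrix (Fin 2) (Fin 2) ℂ) : ⁅A ⊗ₖ σ, B ⊗ₖ τ⁆ = (B * A) ⊗ₖ ⁅σ, τ⁆ := by
  rw [Ring.lie_def, Ring.lie_def, ← Matrix.mul_kronecker_mul, ← Matrix.mul_kronecker_mul, h.eq]
  ext i j
  simp [mul_sub]

theorem lie_pauliY_pauliX : ⁅pauliY, pauliX⁆ = (-(2 * Complex.I)) • pauliZ := by
  ext i j
  fin_cases i <;> fin_cases j <;> simp [Ring.lie_def, pauliX, pauliY, pauliZ] <;> ring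

theorem lie_pauliY_pauliZ : ⁅pauliY, pauliZ⁆ = (2 * Complex.I) • pauliX := by
  ext i j
  fin_cases i <;> fin_cases j <;> simp [Ring.lie_def, pauliX, pauliY, pauliZ] <;> ring

theorem lie_smul_matrix (a : ℂ) (σ τ : Matrix (Fin 2) (Fin 2) ℂ) : ⁅σ, a • τ⁆ = a • ⁅σ, τ⁆ := by
  rw [Ring.lie_def, Ring.lie_def, mul_smul_comm, smul_mul_assoc, smul_sub]

/-- The coefficient and the Pauli matrix of the nested commutator of the dilation. -/
def commutatorPauli (k : ℕ) : Matrix (Fin 2) (Fin 2) ℂ :=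
  if Odd k then (-(Complex.I * 2 ^ k)) • pauliZ else (2 ^ k : ℂ) • pauliX

theorem lie_pauliY_commutatorPauli (k : ℕ) :
    ⁅pauliY, commutatorPauli k⁆ = commutatorPauli (k + 1) := by
  rcases Nat.even_or_odd k with h | h
  · rw [commutatorPauli, commutatorPauli, if_neg (Nat.not_odd_iff_even.2 h), if_pos h.add_one,
      lie_smul_matrix, lie_pauliY_pauliX, smul_smul]
    congr 1
    ring
  · rw [commutatorPauli, commutatorPauli, if_pos h, if_neg (Nat.not_odd_iff_even.2 h.add_one),
      lie_smul_matrix, lie_pauliY_pauliZ, smul_smul]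
    congr 1
    ring_nf
    simp

theorem nestedCommutator_dilation_eq_prod :
    ∀ (k : ℕ) (B : Fin (k + 1) → Matrix (Fin n) (Fin n) ℂ), (∀ i j, Commute (B i) (B j)) →
      nestedCommutator k (dilation B) = (List.ofFn B).prod ⊗ₖ commutatorPauli k
  | 0, B, _ => by simp [nestedCommutator, dilation, dilationPauli, commutatorPauli]
  | k + 1, B, hB => by
    have e : (fun j : Fin (k + 1) => dilation B j.castSucc) =
        dilation fun j : Fin (k + 1) => B j.castSucc := by
      ext1 j
      simp [dilation, dilationPauli]
    have hl : dilation B (Fin.last (k + 1)) = B (Fin.last (k + 1)) ⊗ₖ pauliY := by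
      simp [dilation, dilationPauli, Fin.ext_iff]
    have hc : Commute (B (Fin.last (k + 1)))
        (List.ofFn fun j : Fin (k + 1) => B j.castSucc).prod := by
      refine Commute.list_prod_right _ _ fun x hx => ?_
      obtain ⟨j, rfl⟩ := (List.mem_ofFn' _ _).1 hx
      exact hB _ _
    rw [nestedCommutator, e, nestedCommutator_dilation_eq_prod k _ fun i j => hB _ _, hl,
      commutator_kronecker hc, lie_pauliY_commutatorPauli, List.ofFn_succ' B, List.concat_eq_append,
      List.prod_append, List.prod_singleton]

/-- The arrangement is a permutation of the list of constant blocks, and commuting factors may be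
permuted. -/
theorem prod_ofFn_arrangement {m k : ℕ} {A : Fin m → Matrix (Fin n) (Fin n) ℂ}
    (hA : ∀ l l', Commute (A l) (A l')) {α : Fin m → ℕ} {c : Fin (k + 1) → Fin m}
    (hc : IsArrangement α c) : (List.ofFn fun j => A (c j)).prod = powerProduct A α := by
  have hperm : (List.ofFn c).Perm (List.ofFn fun l => List.replicate (α l) l).flatten := by
    rw [List.perm_iff_count]
    intro l
    have h1 : List.count l (List.ofFn c) = α l := by
      rw [← hc l, List.ofFn_eq_map, List.count_eq_countP, List.countP_map,
        List.countP_eq_length_filter]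
      simp [Finset.card, Finset.filter, Fin.univ_def, Function.comp_def]
      rfl
    rw [List.count_flatten, List.map_ofFn, List.sum_ofFn, h1]
    simp [List.count_replicate]
  have h := (hperm.map A).prod_eq' (List.pairwise_map.2 (List.pairwise_of_forall fun x y => hA x y))
  rw [List.map_ofFn] at h
  rw [Function.comp_def] at h
  rw [h, powerProduct, List.map_flatten, List.prod_flatten, List.map_ofFn, List.map_ofFn]
  simp [Function.comp_def]

theorem nestedCommutator_dilation {m k : ℕ} {A : Fin m → Matrix (Fin n) (Fin n) ℂ}
    (hA : ∀ l l', Commute (A l) (A l')) {α : Fin m → ℕ} {c : Fin (k + 1) → Fin m}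
    (hc : IsArrangement α c) :
    nestedCommutator k (dilation fun j => A (c j)) = powerProduct A α ⊗ₖ commutatorPauli k := by
  rw [nestedCommutator_dilation_eq_prod k _ fun i j => hA _ _, prod_ofFn_arrangement hA hc]

/-- The Pauli matrix that has the ancilla state as an eigenvector. -/
def ancillaPauli (k : ℕ) : Matrix (Fin 2) (Fin 2) ℂ :=
  if Odd k then pauliZ else pauliX

theorem ancillaPauli_mulVec (k : ℕ) (i : Fin 2) :
    ∑ j, ancillaPauli k i j * ancilla k j = ancilla k i := by
  unfold ancillaPauli ancilla
  split_ifs <;> fin_cases i <;> simp [pauliX, pauliZ]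

theorem norm_ancilla (k : ℕ) : ‖ancilla k‖ = 1 := by
  unfold ancilla
  split_ifs
  · simp [EuclideanSpace.norm_eq]
  · simp [EuclideanSpace.norm_eq]
    norm_num

theorem norm_tensorState (ψ : EuclideanSpace ℂ (Fin n)) (φ : EuclideanSpace ℂ (Fin 2)) :
    ‖tensorState ψ φ‖ = ‖ψ‖ * ‖φ‖ := by
  simp only [EuclideanSpace.norm_eq, tensorState]
  rw [← Real.sqrt_mul (by positivity), Finset.sum_mul_sum, Fintype.sum_prod_type]
  simp [mul_pow]

/-- The map `ψ ↦ ψ ⊗ φ` as a continuous linear map. -/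
noncomputable def tensorStateCLM (n : ℕ) (φ : EuclideanSpace ℂ (Fin 2)) :
    EuclideanSpace ℂ (Fin n) →L[ℂ] EuclideanSpace ℂ (Fin n × Fin 2) :=
  LinearMap.toContinuousLinearMap
    { toFun := fun ψ => tensorState ψ φ
      map_add' := fun ψ ψ' => by ext x; simp [tensorState, add_mul]
      map_smul' := fun a ψ => by ext x; simp [tensorState, mul_assoc] }

theorem tensorStateCLM_apply (φ : EuclideanSpace ℂ (Fin 2)) (ψ : EuclideanSpace ℂ (Fin n)) :
    tensorStateCLM n φ ψ = tensorState ψ φ := rfl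

theorem exp_intertwine {E F : Type*} [NormedAddCommGroup E] [NormedSpace ℂ E] [CompleteSpace E]
    [NormedAddCommGroup F] [NormedSpace ℂ F] [CompleteSpace F] {S : F →L[ℂ] F} {T : E →L[ℂ] E}
    {J : E →L[ℂ] F} (h : S ∘L J = J ∘L T) (x : E) :
    NormedSpace.exp S (J x) = J (NormedSpace.exp T x) := by
  have hpow : ∀ (i : ℕ) (x : E), (S ^ i) (J x) = J ((T ^ i) x) := by
    intro i
    induction i with
    | zero => simp
    | succ i ih =>
      intro x
      have h' : S (J x) = J (T x) := congrArg (fun f => f x) h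
      rw [pow_succ, pow_succ, mul_apply_eq_comp, mul_apply_eq_comp, h', ih]
  have hS := (NormedSpace.exp_series_hasSum_exp' (𝕂 := ℂ) S).mapL
    (ContinuousLinearMap.apply ℂ F (J x))
  have hT := ((NormedSpace.exp_series_hasSum_exp' (𝕂 := ℂ) T).mapL
    (ContinuousLinearMap.apply ℂ E x)).mapL J
  refine hS.unique ?_
  convert hT using 2 with i
  · simp [hpow]
  · rfl

theorem toEuclideanCLM_exp {ι : Type*} [Fintype ι] [DecidableEq ι] (M : Matrix ι ι ℂ) :
    Matrix.toEuclideanCLM (𝕜 := ℂ) (NormedSpace.exp M) =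
      NormedSpace.exp (Matrix.toEuclideanCLM (𝕜 := ℂ) M) := by
  let +nondep : NormedAlgebra ℚ (Matrix ι ι ℂ) := .restrictScalars ℚ ℂ _
  exact NormedSpace.map_exp (Matrix.toEuclideanCLM (n := ι) (𝕜 := ℂ))
    (LinearMap.continuous_of_finiteDimensional
      (Matrix.toEuclideanCLM (n := ι) (𝕜 := ℂ)).toAlgEquiv.toLinearMap) M

/-- The ancilla has eigenvalue 1, so tensoring with it intertwines `Q` with `Q ⊗ σ`, hence also
their exponentials. -/
theorem exp_kronecker_tensorState (k : ℕ) (Q : Matrix (Fin n) (Fin n) ℂ)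
    (ψ : EuclideanSpace ℂ (Fin n)) :
    Matrix.toEuclideanCLM (𝕜 := ℂ) (NormedSpace.exp (Q ⊗ₖ ancillaPauli k))
        (tensorState ψ (ancilla k)) =
      tensorState (Matrix.toEuclideanCLM (𝕜 := ℂ) (NormedSpace.exp Q) ψ) (ancilla k) := by
  rw [toEuclideanCLM_exp, toEuclideanCLM_exp, ← tensorStateCLM_apply, ← tensorStateCLM_apply]
  refine exp_intertwine ?_ ψ
  ext ψ x
  simp only [ContinuousLinearMap.comp_apply, tensorStateCLM_apply, Matrix.ofLp_toEuclideanCLM,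
    tensorState, Matrix.mulVec, dotProduct, Fintype.sum_prod_type, Matrix.kroneckerMap_apply]
  rw [← ancillaPauli_mulVec k x.2, Finset.sum_mul_sum]
  exact Finset.sum_congr rfl fun i _ => Finset.sum_congr rfl fun j _ => by ring

/-- By the C⋆-identity it suffices to bound `A⋆A ⊗ 1`, and `M ↦ M ⊗ 1` is a star homomorphism, hence
contractive. -/
theorem norm_kronecker_le (A : Matrix (Fin n) (Fin n) ℂ) {σ : Matrix (Fin 2) (Fin 2) ℂ}
    (hσ : σ.conjTranspose * σ = 1) : ‖A ⊗ₖ σ‖ ≤ ‖A‖ := by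
  let φ : Matrix (Fin n) (Fin n) ℂ →⋆ₐ[ℂ] Matrix (Fin n × Fin 2) (Fin n × Fin 2) ℂ :=
    { toFun := fun M => M ⊗ₖ (1 : Matrix (Fin 2) (Fin 2) ℂ)
      map_one' := Matrix.one_kronecker_one
      map_mul' := fun M N => by rw [← Matrix.mul_kronecker_mul, one_mul]
      map_zero' := Matrix.zero_kronecker _
      map_add' := fun M N => Matrix.add_kronecker _ _ _
      commutes' := fun a => by
        rw [Algebra.algebraMap_eq_smul_one, Matrix.smul_kronecker, Matrix.one_kronecker_one,
          ← Algebra.algebraMap_eq_smul_one]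
      map_star' := fun M => by
        simp only [Matrix.star_eq_conjTranspose, Matrix.conjTranspose_kronecker,
          Matrix.conjTranspose_one] }
  have h1 : (A ⊗ₖ σ).conjTranspose * (A ⊗ₖ σ) = φ (A.conjTranspose * A) := by
    rw [Matrix.conjTranspose_kronecker, ← Matrix.mul_kronecker_mul, hσ]
    rfl
  have h2 : ‖φ (A.conjTranspose * A)‖ ≤ ‖A.conjTranspose * A‖ :=
    NonUnitalStarAlgHom.norm_apply_le φ _
  rw [← h1, Matrix.l2_opNorm_conjTranspose_mul_self, Matrix.l2_opNorm_conjTranspose_mul_self] at h2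
  exact abs_le_of_sq_le_sq' (by nlinarith) (norm_nonneg _) |>.2

theorem norm_dilation_le {k : ℕ} (B : Fin (k + 1) → Matrix (Fin n) (Fin n) ℂ) (j : Fin (k + 1)) :
    ‖dilation B j‖ ≤ ‖B j‖ := by
  refine norm_kronecker_le _ ?_
  unfold dilationPauli
  ext i j
  split_ifs <;> fin_cases i <;> fin_cases j <;> 
    simp [pauliX, pauliY, Matrix.mul_apply]

theorem isHermitian_dilation {k : ℕ} {B : Fin (k + 1) → Matrix (Fin n) (Fin n) ℂ}
    (hB : ∀ j, (B j).IsHermitian) (j : Fin (k + 1)) : (dilation B j).IsHermitian := by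
  have h : (dilationPauli j).IsHermitian := by
    unfold dilationPauli
    ext i j
    split_ifs <;> fin_cases i <;> fin_cases j <;> simp [pauliX, pauliY]
  rw [Matrix.IsHermitian, dilation, Matrix.conjTranspose_kronecker, (hB j).eq, h.eq]

end Dilation

/-! ### Choosing the number of segments -/

section StepCount

theorem rpow_one_div_natCast_pow {x : ℝ} {n : ℕ} (hn : 0 < n) (hx : 0 ≤ x) :
    (x ^ (1 / n : ℝ)) ^ n = x := by
  rw [one_div, Real.rpow_inv_natCast_pow hx hn.ne']

theorem stepBound_pow {k p : ℕ} (hp : 0 < p) {Λ t ε : ℝ} (hx : 0 ≤ Λ * t) (hε : 0 < ε) :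
    stepBound k p Λ t ε ^ (2 * p) =
      ((6 : ℝ) ^ (p * k) * (Λ * t)) ^ ((k + 1) * (k + 1 + 2 * p)) / ε ^ (k + 1) := by
  have hp' : (p : ℝ) ≠ 0 := by exact_mod_cast hp.ne'
  have hz : 0 ≤ (6 : ℝ) ^ (p * k) * (Λ * t) := by positivity
  rw [stepBound, div_pow, ← Real.rpow_natCast (_ ^ _), ← Real.rpow_natCast (ε ^ _),
    ← Real.rpow_mul hz, ← Real.rpow_mul hε.le, ← Real.rpow_natCast _ ((k + 1) * _),
    ← Real.rpow_natCast ε]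
  congr 2 <;> push_cast <;> field_simp
  ring

theorem stepBound_nonneg {k p : ℕ} {Λ t ε : ℝ} (hx : 0 ≤ Λ * t) (hε : 0 < ε) :
    0 ≤ stepBound k p Λ t ε := by
  unfold stepBound
  positivity

/-- Here `F ^ (2 * p) ≥ ε ^ (-(k + 1)) ≥ 2 ^ (-(k + 1))`. This lets `max 1 F` be replaced by a
constant times `F`. -/
theorem one_le_two_pow_mul_stepBound {k p : ℕ} (hp : 0 < p) {Λ t ε : ℝ} (hx : 1 ≤ Λ * t)
    (hε : 0 < ε) (hε2 : ε ≤ 2) : 1 ≤ 2 ^ (k + 1) * stepBound k p Λ t ε := by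
  have hF := stepBound_nonneg (k := k) (p := p) (zero_le_one.trans hx) hε
  refine le_of_pow_le_pow_left₀ (n := 2 * p) (by omega) (by positivity) ?_
  rw [one_pow, mul_pow, stepBound_pow hp (zero_le_one.trans hx) hε, ← mul_div_assoc,
    le_div_iff₀ (by positivity), one_mul]
  have h1 : (1 : ℝ) ≤ ((6 : ℝ) ^ (p * k) * (Λ * t)) ^ ((k + 1) * (k + 1 + 2 * p)) :=
    one_le_pow₀ (one_le_mul_of_one_le_of_one_le (one_le_pow₀ (by norm_num)) hx)
  calc ε ^ (k + 1) ≤ 2 ^ (k + 1) := by gcongr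
    _ ≤ (2 ^ (k + 1)) ^ (2 * p) := le_self_pow₀ (one_le_pow₀ (by norm_num)) (by omega)
    _ ≤ _ := le_mul_of_one_le_right (by positivity) h1

/-- The number of segments into which the evolution has to be cut. -/
theorem exists_segment_count {k p : ℕ} (hk : 0 < k) (hp : 0 < p) {T Λ t ε : ℝ} (hT : 1 ≤ T)
    (hx : 0 ≤ Λ * t) (hε : 0 < ε) (hε2 : ε ≤ 2) :
    ∃ r : ℕ, 0 < r ∧
      (∀ u : ℝ, 0 ≤ u → u ^ (k + 1) * r = (T * 6 ^ p * (Λ * t)) ^ (k + 1) →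
        u ≤ 1 ∧ r * (6 * u ^ (k + 2 + 2 * p)) ≤ ε) ∧
      (r : ℝ) ≤ 2 * (6 ^ (k + 1) * T ^ ((k + 1) * (k + 2))) * max 1 (stepBound k p Λ t ε) := by
  set w := T * 6 ^ p * (Λ * t) with hw
  set F := stepBound k p Λ t ε with hFdef
  have hF : 0 ≤ F := stepBound_nonneg hx hε
  have hT0 : 0 ≤ T := by linarith
  have hw0 : 0 ≤ w := by positivity
  -- Eliminating `u` through `u ^ (k + 1) * r = w ^ (k + 1)` turns `r * 6 * u ^ (k + 1 + 2 * p) ≤ ε`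
  -- into `g ≤ r ^ (2 * p)`.
  set g := 6 ^ (k + 1) * w ^ ((k + 1) * (k + 1 + 2 * p)) / ε ^ (k + 1) with hg
  have hg0 : 0 ≤ g := by positivity
  set G := g ^ (1 / (2 * p : ℕ) : ℝ) with hGdef
  have hG0 : 0 ≤ G := by positivity
  have hG : G ^ (2 * p) = g := rpow_one_div_natCast_pow (by omega) hg0
  set K := 6 ^ (k + 1) * T ^ ((k + 1) * (k + 2)) with hK
  have hK1 : 1 ≤ K := one_le_mul_of_one_le_of_one_le (one_le_pow₀ (by norm_num)) (one_le_pow₀ hT)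
  have hGF : G ≤ K * F := by
    refine le_of_pow_le_pow_left₀ (n := 2 * p) (by omega) (by positivity) ?_
    rw [hG, mul_pow, hFdef, stepBound_pow hp hx hε, hg, ← mul_div_assoc]
    refine div_le_div_of_nonneg_right ?_ (by positivity)
    have h1 : w ≤ T * (6 ^ (p * k) * (Λ * t)) := by
      rw [hw, mul_assoc]
      have : (6 : ℝ) ^ p ≤ 6 ^ (p * k) :=
        pow_le_pow_right₀ (by norm_num) (Nat.le_mul_of_pos_right p hk)
      gcongr
    calc 6 ^ (k + 1) * w ^ ((k + 1) * (k + 1 + 2 * p))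
        ≤ 6 ^ (k + 1) * (T * (6 ^ (p * k) * (Λ * t))) ^ ((k + 1) * (k + 1 + 2 * p)) := by gcongr
      _ = (6 ^ (k + 1) * T ^ ((k + 1) * (k + 1 + 2 * p))) *
          (6 ^ (p * k) * (Λ * t)) ^ ((k + 1) * (k + 1 + 2 * p)) := by rw [mul_pow T, mul_assoc]
      _ ≤ _ := by
        refine mul_le_mul_of_nonneg_right ?_ (by positivity)
        -- Since `p ≥ 1`, `k + 1 + 2 * p ≤ (k + 2) * (2 * p)`; after the `2 * p`-th root the power
        -- of `T` no longer depends on `p`.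
        rw [hK, mul_pow, ← pow_mul, ← pow_mul]
        refine mul_le_mul (pow_le_pow_right₀ (by norm_num) (Nat.le_mul_of_pos_right _ (by omega)))
          (pow_le_pow_right₀ hT ?_) (by positivity) (by positivity)
        rw [mul_assoc]
        refine Nat.mul_le_mul_left _ ?_
        nlinarith
  refine ⟨⌈max 1 G⌉₊, Nat.ceil_pos.2 (by positivity), ?_, ?_⟩
  · intro u hu huw
    have hr : max 1 G ≤ (⌈max 1 G⌉₊ : ℝ) := Nat.le_ceil _
    set r : ℝ := (⌈max 1 G⌉₊ : ℝ) with hrdef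
    have hr1 : 1 ≤ r := (le_max_left _ _).trans hr
    have hrG : G ≤ r := (le_max_right _ _).trans hr
    have hr0 : 0 < r := by linarith
    have hwr : w ^ (k + 1) ≤ r := by
      rcases le_total w 1 with h | h
      · exact (pow_le_one₀ hw0 h).trans hr1
      · refine le_trans ?_ hrG
        refine le_of_pow_le_pow_left₀ (n := 2 * p) (by omega) hG0 ?_
        rw [hG, hg, le_div_iff₀ (by positivity), mul_comm, ← pow_mul]
        have : w ^ ((k + 1) * (2 * p)) ≤ w ^ ((k + 1) * (k + 1 + 2 * p)) :=
          pow_le_pow_right₀ h (Nat.mul_le_mul_left _ (by omega))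
        have : ε ^ (k + 1) ≤ 6 ^ (k + 1) := by
          gcongr
          linarith
        gcongr
    have hu1 : u ≤ 1 := by
      refine le_of_pow_le_pow_left₀ (n := k + 1) (by omega) zero_le_one ?_
      rw [one_pow]
      refine le_of_mul_le_mul_right ?_ hr0
      rwa [huw, one_mul]
    refine ⟨hu1, ?_⟩
    -- One order of accuracy is given away; the exponents of `stepBound` correspond to order `k + 1
    -- + 2 * p`.
    have h1 : u ^ (k + 2 + 2 * p) ≤ u ^ (k + 1 + 2 * p) := pow_le_pow_of_le_one hu hu1 (by omega)
    have h2 : g ≤ r ^ (2 * p) := by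
      rw [← hG]
      gcongr
    refine le_trans (b := r * (6 * u ^ (k + 1 + 2 * p))) (by gcongr) ?_
    refine le_of_pow_le_pow_left₀ (n := k + 1) (by omega) hε.le ?_
    have h3 : 6 ^ (k + 1) * w ^ ((k + 1) * (k + 1 + 2 * p)) ≤ r ^ (2 * p) * ε ^ (k + 1) :=
      (div_le_iff₀ (by positivity)).1 h2
    refine le_of_mul_le_mul_right (a := r ^ (2 * p)) ?_ (by positivity)
    calc (r * (6 * u ^ (k + 1 + 2 * p))) ^ (k + 1) * r ^ (2 * p)
        = 6 ^ (k + 1) * (u ^ (k + 1) * r) ^ (k + 1 + 2 * p) := by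
          simp only [mul_pow, ← pow_mul, pow_add r]
          ring
      _ = 6 ^ (k + 1) * w ^ ((k + 1) * (k + 1 + 2 * p)) := by rw [huw, ← pow_mul]
      _ ≤ _ := by rwa [mul_comm (ε ^ _)]
  · have h1 := (Nat.ceil_lt_add_one (a := max 1 G) (by positivity)).le
    have h2 : max 1 G ≤ K * max 1 F := by
      refine max_le ?_ (hGF.trans ?_)
      · exact one_le_mul_of_one_le_of_one_le hK1 (le_max_left _ _)
      · gcongr
        exact le_max_right _ _
    have h3 : (1 : ℝ) ≤ K * max 1 F := (le_max_left _ _).trans h2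
    linarith

end StepCount

/-! ### Simulating the exponential of a nested commutator -/

section Simulation

variable {n : ℕ}

theorem productFormula_eq_evolve {ι κ : Type*} [Fintype κ] [DecidableEq κ] (X : ι → Matrix κ κ ℂ)
    (L : List (ι × ℝ)) : productFormula X L = evolve (fun j => (-Complex.I) • X j) L 1 := by
  simp only [productFormula, evolve, smul_smul, one_mul]
  congr 2
  ext1 g
  rw [show -(Complex.I * (g.2 : ℂ)) = g.2 * -Complex.I by ring]

theorem nestedCommutator_smul {𝔸 : Type*} [Ring 𝔸] [Algebra ℂ 𝔸] (a : ℂ) :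
    ∀ (k : ℕ) (X : Fin (k + 1) → 𝔸),
      nestedCommutator k (fun j => a • X j) = a ^ (k + 1) • nestedCommutator k X
  | 0, X => by simp [nestedCommutator]
  | k + 1, X => by
    rw [nestedCommutator, nestedCommutator, nestedCommutator_smul a k, Ring.lie_def, Ring.lie_def]
    simp only [smul_mul_smul_comm, smul_sub]
    rw [← pow_succ', ← pow_succ]

theorem nestedCommutator_mem_skewAdjoint {𝔸 : Type*} [Ring 𝔸] [StarRing 𝔸] :
    ∀ (k : ℕ) (X : Fin (k + 1) → 𝔸), (∀ j, X j ∈ skewAdjoint 𝔸) →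
      nestedCommutator k X ∈ skewAdjoint 𝔸
  | 0, X, hX => hX 0
  | k + 1, X, hX => by
    have ih := nestedCommutator_mem_skewAdjoint k (fun j => X j.castSucc) fun j => hX _
    have h := hX (Fin.last (k + 1))
    rw [skewAdjoint.mem_iff] at ih h ⊢
    rw [nestedCommutator, Ring.lie_def, star_sub, star_mul, star_mul, ih, h]
    noncomm_ring

/-- The generator of the dilated target evolution. -/
noncomputable def targetGenerator (k : ℕ) (P : Matrix (Fin n) (Fin n) ℂ) :
    Matrix (Fin n × Fin 2) (Fin n × Fin 2) ℂ :=
  (-(Complex.I * 2 ^ k)) • (P ⊗ₖ ancillaPauli k)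

theorem neg_I_pow_eq_or {j : ℕ} (h : Even j) : (-Complex.I) ^ j = 1 ∨ (-Complex.I) ^ j = -1 := by
  obtain ⟨i, rfl⟩ := h
  rw [← two_mul, pow_mul, neg_sq, Complex.I_sq]
  exact neg_one_pow_eq_or ℂ i

/-- The factors `-i` contribute `(-i) ^ (k + 1)`. Apart from the `-i` in the target, an even power
of `-i` remains, hence a sign. -/
theorem targetGenerator_eq_or {k : ℕ} {P : Matrix (Fin n) (Fin n) ℂ}
    {X : Fin (k + 1) → Matrix (Fin n × Fin 2) (Fin n × Fin 2) ℂ}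
    (hX : nestedCommutator k X = P ⊗ₖ commutatorPauli k) :
    nestedCommutator k (fun j => (-Complex.I) • X j) = targetGenerator k P ∨
      nestedCommutator k (fun j => (-Complex.I) • X j) = -targetGenerator k P := by
  have key : ∃ j, Even j ∧ nestedCommutator k (fun j => (-Complex.I) • X j) =
      (-Complex.I) ^ j • targetGenerator k P := by
    rw [nestedCommutator_smul, hX, targetGenerator, commutatorPauli, ancillaPauli]
    rcases Nat.even_or_odd k with h | h
    · refine ⟨k, h, ?_⟩
      rw [if_neg (Nat.not_odd_iff_even.2 h), if_neg (Nat.not_odd_iff_even.2 h),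
        Matrix.kronecker_smul, smul_smul, smul_smul]
      congr 1
      ring
    · refine ⟨k + 1, h.add_one, ?_⟩
      rw [if_pos h, if_pos h, Matrix.kronecker_smul]
  obtain ⟨j, hj, h⟩ := key
  rw [h]
  rcases neg_I_pow_eq_or hj with h | h <;> simp [h]

theorem simulatesWithin_of_norm_sub_le {k : ℕ} {P : Matrix (Fin n) (Fin n) ℂ}
    {V : Matrix (Fin n × Fin 2) (Fin n × Fin 2) ℂ} {t ε : ℝ}
    (h : ‖V - NormedSpace.exp (((t : ℂ) ^ (k + 1)) • targetGenerator k P)‖ ≤ ε) :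
    SimulatesWithin V (ancilla k)
      (NormedSpace.exp ((-(Complex.I * 2 ^ k * (t : ℂ) ^ (k + 1))) • P)) ε := by
  intro ψ
  have e : ((t : ℂ) ^ (k + 1)) • targetGenerator k P =
      ((-(Complex.I * 2 ^ k * (t : ℂ) ^ (k + 1))) • P) ⊗ₖ ancillaPauli k := by
    rw [targetGenerator, smul_smul, Matrix.smul_kronecker]
    congr 1
    ring
  rw [← exp_kronecker_tensorState, ← e, ← sub_apply, ← map_sub]
  refine (ContinuousLinearMap.le_opNorm _ _).trans ?_
  rw [norm_tensorState, norm_ancilla, mul_one, ← Matrix.cstar_norm_def]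
  gcongr

theorem norm_le_one_of_mem_unitary {𝔸 : Type*} [NormedRing 𝔸] [StarRing 𝔸] [CStarRing 𝔸] {U : 𝔸}
    (hU : U ∈ unitary 𝔸) : ‖U‖ ≤ 1 := by
  nontriviality 𝔸
  exact (CStarRing.norm_of_mem_unitary hU).le

variable {𝔸 : Type*} [CStarAlgebra 𝔸]

theorem exp_mem_unitary_complex {x : 𝔸} (hx : x ∈ skewAdjoint 𝔸) :
    NormedSpace.exp x ∈ unitary 𝔸 := by
  let +nondep : NormedAlgebra ℚ 𝔸 := .restrictScalars ℚ ℂ 𝔸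
  exact NormedSpace.exp_mem_unitary_of_mem_skewAdjoint hx

theorem ofReal_smul_mem_skewAdjoint {x : 𝔸} (hx : x ∈ skewAdjoint 𝔸) (s : ℝ) :
    (s : ℂ) • x ∈ skewAdjoint 𝔸 := by
  rw [skewAdjoint.mem_iff] at hx ⊢
  simp [star_smul, hx]

theorem evolve_mem_unitary {ι : Type*} {H : ι → 𝔸} (hH : ∀ j, H j ∈ skewAdjoint 𝔸)
    (L : List (ι × ℝ)) (y : ℝ) : evolve H L y ∈ unitary 𝔸 := by
  refine list_prod_mem fun x hx => ?_
  obtain ⟨g, -, rfl⟩ := List.mem_map.1 hx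
  rw [← Complex.ofReal_mul]
  exact exp_mem_unitary_complex (ofReal_smul_mem_skewAdjoint (hH g.1) _)

theorem exp_natCast_smul {𝔸 : Type*} [NormedRing 𝔸] [NormedAlgebra ℂ 𝔸] [CompleteSpace 𝔸] (r : ℕ)
    (x : 𝔸) : NormedSpace.exp ((r : ℂ) • x) = NormedSpace.exp x ^ r := by
  let +nondep : NormedAlgebra ℚ 𝔸 := .restrictScalars ℚ ℂ 𝔸
  rw [Nat.cast_smul_eq_nsmul, NormedSpace.exp_nsmul]

/-- Simulation of `exp (t ^ (k + 1) Y)`, where `Y` is the nested commutator up to its sign. -/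
theorem exists_word_norm_sub_le [Nontrivial 𝔸] {k p : ℕ} (hk : 0 < k) (hp : 0 < p) {C : ℝ}
    (hC1 : 1 ≤ C)
    (hC : ∀ p, ∏ i ∈ Finset.range p, timeRatio (k + 1) (k + 1 + 2 + 2 * i) ≤ C * 6 ^ p)
    {H : Fin (k + 1) → 𝔸} (hH : ∀ j, H j ∈ skewAdjoint 𝔸) {Y : 𝔸}
    (hY : nestedCommutator k H = Y ∨ nestedCommutator k H = -Y) {Λ t ε : ℝ} (hΛ : 0 < Λ)
    (hHΛ : ∀ j, 2 * ‖H j‖ ≤ Λ) (ht : 0 ≤ t) (hε : 0 < ε) (hε2 : ε ≤ 2) :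
    ∃ L : List (Fin (k + 1) × ℝ),
      ‖evolve H L 1 - NormedSpace.exp (((t : ℂ) ^ (k + 1)) • Y)‖ ≤ ε ∧
      (L.length : ℝ) ≤ 2 * (6 ^ (k + 1) * (3 * 2 ^ k * C) ^ ((k + 1) * (k + 2))) *
        max 1 (stepBound k p Λ t ε) * (3 * 2 ^ k * 6 ^ p) := by
  have hbase : ∃ L : List (Fin (k + 1) × ℝ), L.length ≤ 3 * 2 ^ k ∧ totalTime L ≤ 3 * 2 ^ k ∧
      ∃ e, HasJet (k + 1) (k + 2) Y H L 1 e := by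
    obtain ⟨L, h1, h2, e, he⟩ := exists_hasJet_nestedCommutator k H
    rcases hY with h | h
    · exact ⟨L, h1, h2, e, h ▸ he⟩
    · refine ⟨inverseWord L, by simpa using h1, by simpa using h2, ?_⟩
      have h' := he.neg (by omega) (by omega)
      rwa [h, neg_neg] at h'
  obtain ⟨L, hLlen, hLtime, e, hL⟩ := hbase
  obtain ⟨M, hMlen, hMtime, f, hM⟩ := hL.iterate_raise_order (by omega) p
  set T := 3 * 2 ^ k * C with hT
  have hT1 : 1 ≤ T := by
    have : (1 : ℝ) ≤ 2 ^ k := one_le_pow₀ (by norm_num)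
    nlinarith
  have hMT : totalTime M ≤ T * 6 ^ p := by
    rw [hMtime]
    calc _ ≤ (C * 6 ^ p) * (3 * 2 ^ k) :=
          mul_le_mul (hC p) hLtime (totalTime_nonneg L) (by positivity)
      _ = T * 6 ^ p := by rw [hT]; ring
  have hT6 : 1 ≤ T * 6 ^ p :=
    one_le_mul_of_one_le_of_one_le hT1 (one_le_pow₀ (by norm_num))
  obtain ⟨r, hr, hseg, hrle⟩ := exists_segment_count hk hp hT1 (mul_nonneg hΛ.le ht) hε hε2
  have hr0 : (0 : ℝ) < r := by exact_mod_cast hr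
  -- The target depends on `t ^ (k + 1)`, so equal segments need `r * y ^ (k + 1) = t ^ (k + 1)`,
  -- not `r * y = t`.
  set y : ℝ := t / (r : ℝ) ^ (1 / (k + 1 : ℕ) : ℝ) with hy
  have hy0 : 0 ≤ y := by positivity
  have hyr : r * y ^ (k + 1) = t ^ (k + 1) := by
    rw [hy, div_pow, rpow_one_div_natCast_pow (by omega) hr0.le]
    field_simp
  obtain ⟨hu1, hu⟩ := hseg (Λ * (T * 6 ^ p) * y) (by positivity) (by
    rw [mul_pow _ y, mul_assoc, mul_comm _ (r : ℝ), hyr, ← mul_pow]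
    congr 1
    ring)
  have hH' : ∀ j, ‖H j‖ ≤ Λ := fun j => by linarith [hHΛ j, norm_nonneg (H j)]
  have hYΛ : ‖Y‖ ≤ Λ ^ (k + 1) := by
    have h := norm_nestedCommutator_le (h := Λ / 2) (by positivity) k H
      (fun j => by linarith [hHΛ j])
    rw [mul_div_cancel₀ _ two_ne_zero] at h
    rcases hY with h' | h' <;> simpa [h'] using h
  have hYskew : Y ∈ skewAdjoint 𝔸 := by
    have h := nestedCommutator_mem_skewAdjoint k H hH
    rcases hY with h' | h'
    · rwa [h'] at h
    · rw [h'] at h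
      simpa using neg_mem h
  have herr := hM.norm_sub_le hΛ hT6 hH' hYΛ hMT hy0 hu1
  refine ⟨(List.replicate r (rescale y M)).flatten, ?_, ?_⟩
  · have h1 : NormedSpace.exp (((t : ℂ) ^ (k + 1)) • Y) =
        NormedSpace.exp (((y : ℂ) ^ (k + 1)) • Y) ^ r := by
      rw [← exp_natCast_smul, smul_smul]
      congr 2
      exact_mod_cast hyr.symm
    rw [evolve_flatten_replicate, evolve_rescale, mul_one, h1]
    refine (norm_pow_sub_pow_le_mul ?_ ?_ r).trans ?_
    · exact norm_le_one_of_mem_unitary (evolve_mem_unitary hH M y)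
    · rw [← Complex.ofReal_pow]
      exact norm_le_one_of_mem_unitary
        (exp_mem_unitary_complex (ofReal_smul_mem_skewAdjoint hYskew _))
    · rw [show k + 1 + 1 + 2 * p = k + 2 + 2 * p by ring] at herr
      exact (mul_le_mul_of_nonneg_left herr hr0.le).trans hu
  · have hlen : ((List.replicate r (rescale y M)).flatten.length : ℝ) = r * (6 ^ p * L.length) := by
      simp [List.length_flatten, hMlen]
    rw [hlen]
    have hL' : (L.length : ℝ) ≤ 3 * 2 ^ k := by exact_mod_cast hLlen
    calc (r : ℝ) * (6 ^ p * L.length) ≤ r * (3 * 2 ^ k * 6 ^ p) := by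
          rw [mul_comm (3 * 2 ^ k : ℝ)]
          gcongr
      _ ≤ _ := by gcongr

end Simulation

/-! ### Degenerate cases and assembly -/

theorem smul_neg_I_mem_skewAdjoint {𝔸 : Type*} [CStarAlgebra 𝔸] {x : 𝔸} (hx : IsSelfAdjoint x) :
    (-Complex.I) • x ∈ skewAdjoint 𝔸 := by
  rw [skewAdjoint.mem_iff, star_smul, hx.star_eq]
  simp

/-- Without any exponential, the error is at most `2`. -/
theorem norm_one_sub_exp_le_two {𝔸 : Type*} [CStarAlgebra 𝔸] {Y : 𝔸} (hY : Y ∈ skewAdjoint 𝔸) :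
    ‖1 - NormedSpace.exp Y‖ ≤ 2 := by
  have h1 := norm_le_one_of_mem_unitary (one_mem (unitary 𝔸))
  have h2 := norm_le_one_of_mem_unitary (exp_mem_unitary_complex hY)
  linarith [norm_sub_le 1 (NormedSpace.exp Y)]

theorem targetGenerator_zero {n : ℕ} (P : Matrix (Fin n) (Fin n) ℂ) :
    targetGenerator 0 P = (-Complex.I) • (P ⊗ₖ commutatorPauli 0) := by
  simp [targetGenerator, ancillaPauli, commutatorPauli]

theorem mainTheorem8 (k : ℕ) :
    ∃ C : ℝ, 0 < C ∧
      ∀ (p m n : ℕ) (_hp : 0 < p)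
        (A : Fin m → Matrix (Fin n) (Fin n) ℂ) (_hA : ∀ l, (A l).IsHermitian)
        (_hcomm : ∀ l l', Commute (A l) (A l'))
        (α : Fin m → ℕ) (_hα : ∑ l, α l = k + 1)
        (c : Fin (k + 1) → Fin m) (_hc : IsArrangement α c),
        (nestedCommutator k (dilation fun j => A (c j)) =
          if Odd k then (-(Complex.I * 2 ^ k)) • (powerProduct A α ⊗ₖ pauliZ)
          else (2 ^ k : ℂ) • (powerProduct A α ⊗ₖ pauliX)) ∧
        ∀ (Λ t ε : ℝ) (_hΛ : ∀ l, 2 * ‖A l‖ ≤ Λ) (_ht : 0 ≤ t) (_hε : 0 < ε),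
          ∃ L : List (Fin (k + 1) × ℝ),
            SimulatesWithin (productFormula (dilation fun j => A (c j)) L) (ancilla k)
              (NormedSpace.exp
                ((-(Complex.I * 2 ^ k * (t : ℂ) ^ (k + 1))) • powerProduct A α)) ε ∧
            (L.length : ℝ) ≤ C * (6 ^ (p * k) * max 1 (stepBound k p Λ t ε)) ∧
            (1 ≤ Λ * t → (L.length : ℝ) ≤ C * (6 ^ (p * k) * stepBound k p Λ t ε)) := by
  obtain ⟨C₀, hC₀⟩ := exists_prod_timeRatio_le (Nat.succ_pos k)
  set C₁ := max 1 C₀ with hC₁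
  have hC₁1 : 1 ≤ C₁ := le_max_left _ _
  have hC₁' : ∀ p, ∏ i ∈ Finset.range p, timeRatio (k + 1) (k + 1 + 2 + 2 * i) ≤ C₁ * 6 ^ p :=
    fun p => (hC₀ p).trans (mul_le_mul_of_nonneg_right (le_max_right _ _) (by positivity))
  have h2k : (1 : ℝ) ≤ 2 ^ k := one_le_pow₀ (by norm_num)
  set K : ℝ := 2 * (6 ^ (k + 1) * (3 * 2 ^ k * C₁) ^ ((k + 1) * (k + 2))) * (3 * 2 ^ k) with hK
  have hK1 : 1 ≤ K := by
    have h1 : (1 : ℝ) ≤ 6 ^ (k + 1) := one_le_pow₀ (by norm_num)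
    have h2 : (1 : ℝ) ≤ (3 * 2 ^ k * C₁) ^ ((k + 1) * (k + 2)) :=
      one_le_pow₀ (one_le_mul_of_one_le_of_one_le (by linarith) hC₁1)
    exact one_le_mul_of_one_le_of_one_le (one_le_mul_of_one_le_of_one_le (by norm_num)
      (one_le_mul_of_one_le_of_one_le h1 h2)) (by linarith)
  have h2k1 : (1 : ℝ) ≤ 2 ^ (k + 1) := one_le_pow₀ (by norm_num)
  refine ⟨K * 2 ^ (k + 1), by positivity, ?_⟩
  intro p m n hp A hA hcomm α hα c hc
  have hN := nestedCommutator_dilation hcomm hc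
  refine ⟨?_, ?_⟩
  · rw [hN, commutatorPauli]
    split_ifs <;> rw [Matrix.kronecker_smul]
  intro Λ t ε hΛ ht hε
  have hΛ0 : 0 ≤ Λ := (mul_nonneg zero_le_two (norm_nonneg (A (c 0)))).trans (hΛ (c 0))
  have hx : 0 ≤ Λ * t := mul_nonneg hΛ0 ht
  set P := powerProduct A α with hP
  set H : Fin (k + 1) → Matrix (Fin n × Fin 2) (Fin n × Fin 2) ℂ :=
    fun j => (-Complex.I) • dilation (fun j => A (c j)) j with hH
  have hHskew : ∀ j, H j ∈ skewAdjoint (Matrix (Fin n × Fin 2) (Fin n × Fin 2) ℂ) := fun j =>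
    smul_neg_I_mem_skewAdjoint (isHermitian_dilation (fun j => hA (c j)) j)
  have hHΛ : ∀ j, 2 * ‖H j‖ ≤ Λ := by
    intro j
    have h1 : ‖H j‖ ≤ ‖A (c j)‖ := by
      simp only [hH, norm_smul, norm_neg, Complex.norm_I, one_mul]
      exact norm_dilation_le _ j
    linarith [hΛ (c j)]
  have hY := targetGenerator_eq_or hN
  have hYskew : targetGenerator k P ∈
      skewAdjoint (Matrix (Fin n × Fin 2) (Fin n × Fin 2) ℂ) := by
    have h := nestedCommutator_mem_skewAdjoint k H hHskew
    rcases hY with h' | h'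
    · rwa [h'] at h
    · rw [h'] at h
      simpa using neg_mem h
  have htskew : ((t : ℂ) ^ (k + 1)) • targetGenerator k P ∈
      skewAdjoint (Matrix (Fin n × Fin 2) (Fin n × Fin 2) ℂ) := by
    rw [← Complex.ofReal_pow]
    exact ofReal_smul_mem_skewAdjoint hYskew _
  -- It suffices to count up to `max 1 F` for errors below `2`.
  suffices h : ∃ L : List (Fin (k + 1) × ℝ),
      ‖productFormula (dilation fun j => A (c j)) L -
        NormedSpace.exp (((t : ℂ) ^ (k + 1)) • targetGenerator k P)‖ ≤ ε ∧
      (L.length = 0 ∨ ε ≤ 2 ∧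
        (L.length : ℝ) ≤ K * (6 ^ (p * k) * max 1 (stepBound k p Λ t ε))) by
    obtain ⟨L, hL, hlen⟩ := h
    have hF : 0 ≤ stepBound k p Λ t ε := stepBound_nonneg hx hε
    refine ⟨L, simulatesWithin_of_norm_sub_le hL, ?_, fun hx1 => ?_⟩
    · rcases hlen with h | ⟨-, h⟩
      · rw [h, Nat.cast_zero]
        positivity
      · refine h.trans (mul_le_mul_of_nonneg_right ?_ (by positivity))
        exact le_mul_of_one_le_right (by positivity) h2k1
    · rcases hlen with h | ⟨hε2, h⟩
      · rw [h, Nat.cast_zero]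
        positivity
      · have hmax : max 1 (stepBound k p Λ t ε) ≤ 2 ^ (k + 1) * stepBound k p Λ t ε :=
          max_le (one_le_two_pow_mul_stepBound hp hx1 hε hε2)
            (le_mul_of_one_le_left hF h2k1)
        calc (L.length : ℝ) ≤ K * (6 ^ (p * k) * max 1 (stepBound k p Λ t ε)) := h
          _ ≤ K * (6 ^ (p * k) * (2 ^ (k + 1) * stepBound k p Λ t ε)) := by gcongr
          _ = _ := by ring
  -- For large `ε` the bound `F` can be arbitrarily small, so only the empty word is affordable;
  -- unitarity makes it sufficient.
  rcases lt_or_ge 2 ε with hε2 | hε2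
  · refine ⟨[], ?_, Or.inl rfl⟩
    exact (norm_one_sub_exp_le_two htskew).trans hε2.le
  -- For `k = 0` the factor `6 ^ (p * k)` cannot absorb `6 ^ p`, but a single exponential is exact.
  rcases Nat.eq_zero_or_pos k with rfl | hk
  · refine ⟨[(0, t)], ?_, Or.inr ⟨hε2, ?_⟩⟩
    · have h1 : targetGenerator 0 P = H 0 := by
        rw [targetGenerator_zero, ← hN]
        rfl
      rw [h1, productFormula_eq_evolve]
      simpa [evolve, hH] using hε.le
    · rw [List.length_singleton, Nat.cast_one]
      refine one_le_mul_of_one_le_of_one_le hK1 (one_le_mul_of_one_le_of_one_le ?_ (le_max_left _ _))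
      exact one_le_pow₀ (by norm_num)
  -- The general case needs a nontrivial matrix algebra.
  rcases Nat.eq_zero_or_pos n with rfl | hn
  · refine ⟨[], ?_, Or.inl rfl⟩
    rw [Subsingleton.elim (productFormula (dilation fun j => A (c j)) [] - _) 0, norm_zero]
    exact hε.le
  -- The radius `(Λ * T)⁻¹` requires `Λ > 0`; for `Λ = 0` the generator vanishes.
  rcases hΛ0.eq_or_lt with hΛ0 | hΛ0
  · refine ⟨[], ?_, Or.inl rfl⟩
    have hH0 := norm_nestedCommutator_le (𝔸 := Matrix (Fin n × Fin 2) (Fin n × Fin 2) ℂ)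
      le_rfl k H fun j => by linarith [hHΛ j]
    have hY0 : ‖targetGenerator k P‖ ≤ 0 := by
      change _ ≤ (2 * 0 : ℝ) ^ (k + 1) at hH0
      rw [mul_zero, zero_pow (Nat.succ_ne_zero k)] at hH0
      rcases hY with h' | h'
      · rwa [h'] at hH0
      · rwa [h', norm_neg] at hH0
    rw [norm_le_zero_iff.1 hY0]
    simpa [productFormula] using hε.le
  have : Nonempty (Fin n) := ⟨⟨0, hn⟩⟩
  obtain ⟨L, hL, hlen⟩ := exists_word_norm_sub_le hk hp hC₁1 hC₁' hHskew hY hΛ0 hHΛ ht hε hε2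
  refine ⟨L, by rwa [productFormula_eq_evolve], Or.inr ⟨hε2, hlen.trans ?_⟩⟩
  have h6 : (6 : ℝ) ^ p ≤ 6 ^ (p * k) :=
    pow_le_pow_right₀ (by norm_num) (Nat.le_mul_of_pos_right p hk)
  calc 2 * (6 ^ (k + 1) * (3 * 2 ^ k * C₁) ^ ((k + 1) * (k + 2))) *
        max 1 (stepBound k p Λ t ε) * (3 * 2 ^ k * 6 ^ p)
      = K * (6 ^ p * max 1 (stepBound k p Λ t ε)) := by rw [hK]; ring
    _ ≤ _ := by gcongr
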